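/- Let $R$ and $S$ be associative rings with identity and let ${}_RC_S$ be a semidualizing $(R,S)$-bimodule: ${}_RC$ and $C_S$ admit degreewise finite projective resolutions (over $R$ and over $S^{op}$, respectively), the homothety maps $R\to\operatorname{Hom}_{S^{op}}(C,C)$ and $S\to\operatorname{Hom}_R(C,C)$ are isomorphisms, and $\operatorname{Ext}^{i}_R(C,C)=0=\operatorname{Ext}^{i}_{S^{op}}(C,C)$ for all $i\ge 1$. Let $\mathcal{A}_C(S)$ be the Auslander class, that is, the class of all left $S$-modules $N$ such that $\operatorname{Tor}_i^S(C,N)=0$ and $\operatorname{Ext}^i_R(C,C\otimes_SN)=0$ for all $i\ge 1$ and the canonical map $\mu_N:N\to\operatorname{Hom}_R(C,C\otimes_SN)$, $\mu_N(x)(c)=c\otimes x$, is an isomorphism. Let $\mathcal{I}_C(S)$ be the class of all left $S$-modules isomorphic to $\operatorname{Hom}_R(C,I)$ for some injective left $R$-module $I$. For a class $\mathscr{X}$ of left $S$-modules closed under isomorphisms, the $\mathscr{X}$-projective dimension $\mathscr{X}\text{-}\mathrm{pd}_S\,N$ of a left $S$-module $N$ is the infimum of all integers $n\ge 0$ for which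 there is an exact sequence $0\to X_n\to\cdots\to X_1\to X_0\to N\to 0$ of left $S$-modules with all $X_i\in\mathscr{X}$ (and $\infty$ if there is none). Let $N$ be a left $S$-module with $\mathcal{A}_C(S)\text{-}\mathrm{pd}_S\,N=n<\infty$. Then there exist exact sequences of left $S$-modules $$0\to H\to A\to N\to 0\qquad\text{and}\qquad 0\to N\to H'\to A'\to 0$$ with $A,A'\in\mathcal{A}_C(S)$, such that $\mathcal{I}_C(S)\text{-}\mathrm{pd}_S\,H=n-1$ if $n\ge 1$ and $H=0$ if $n=0$, and $\mathcal{I}_C(S)\text{-}\mathrm{pd}_S\,H'=n$. -/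

import Mathlib

open CategoryTheory
open scoped TensorProduct

universe u

/-! Conventions: `R` and `S` are arbitrary (associative, unital) rings. An `(R, S)`-bimodule `C` is an
abelian group with a left `R`-module structure and a right `S`-module structure, the latter written as a
left module structure over the opposite ring (`MulOpposite.op s • c` is `c s`), which commute. -/

namespace SemidualizingBimodule

section Bimodule

variable (R S : Type u) [Ring R] [Ring S]
variable (C : Type u) [AddCommGroup C] [Module R C] [Module Sᵐᵒᵖ C] [SMulCommClass R Sᵐᵒᵖ C]

/-! ### The homothety maps and semidualizing bimodules -/

/-- The homothety map `R → Hom_{S^op}(C, C)`, `r ↦ (c ↦ r c)`. -/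
def homothetyLeft (r : R) : C →ₗ[Sᵐᵒᵖ] C where
  toFun c := r • c
  map_add' := smul_add r
  map_smul' s c := smul_comm r s c

/-- The homothety map `S → Hom_R(C, C)`, `s ↦ (c ↦ c s)`. -/
def homothetyRight (s : S) : C →ₗ[R] C where
  toFun c := MulOpposite.op s • c
  map_add' := smul_add (MulOpposite.op s)
  map_smul' r c := (smul_comm r (MulOpposite.op s) c).symm

/-- A module admits a degreewise finite projective resolution: a projective resolution all of whose
terms are finitely generated (projective) modules. -/
def HasDegreewiseFiniteProjectiveResolution {A : Type u} [Ring A] (M : ModuleCat.{u} A) : Prop :=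
  ∃ P : ProjectiveResolution M, ∀ i : ℕ, Module.Finite A (P.complex.X i)

/-- The `(R, S)`-bimodule `C` is semidualizing. -/
structure IsSemidualizing : Prop where
  /-- `C` has a degreewise finite projective resolution as a left `R`-module. -/
  finite_left : HasDegreewiseFiniteProjectiveResolution (ModuleCat.of R C)
  /-- `C` has a degreewise finite projective resolution as a right `S`-module. -/
  finite_right : HasDegreewiseFiniteProjectiveResolution (ModuleCat.of Sᵐᵒᵖ C)
  /-- The homothety map `R → Hom_{S^op}(C, C)` is an isomorphism. -/
  bijective_homothetyLeft : Function.Bijective (homothetyLeft R S C)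
  /-- The homothety map `S → Hom_R(C, C)` is an isomorphism. -/
  bijective_homothetyRight : Function.Bijective (homothetyRight R S C)
  /-- `Ext_R^i(C, C) = 0` for all `i ≥ 1`. -/
  ext_left : ∀ i : ℕ, 1 ≤ i →
    Subsingleton (Abelian.Ext (ModuleCat.of R C) (ModuleCat.of R C) i)
  /-- `Ext_{S^op}^i(C, C) = 0` for all `i ≥ 1`. -/
  ext_right : ∀ i : ℕ, 1 ≤ i →
    Subsingleton (Abelian.Ext (ModuleCat.of Sᵐᵒᵖ C) (ModuleCat.of Sᵐᵒᵖ C) i)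

/-! ### The tensor product `C ⊗_S N` over the noncommutative ring `S` -/

/-- The relations `(c s) ⊗ x - c ⊗ (s x)` in `C ⊗_ℤ N`. Since
`r ((c s) ⊗ x - c ⊗ (s x)) = ((r c) s) ⊗ x - (r c) ⊗ (s x)`, the set of these generators is stable under
`R`, so that the `R`-submodule they span is also the subgroup they generate (`balancedRel_toAddSubgroup`). -/
def balancedRel (N : Type u) [AddCommGroup N] [Module S N] : Submodule R (C ⊗[ℤ] N) :=
  Submodule.span R
    {t | ∃ (c : C) (s : S) (x : N), t = (MulOpposite.op s • c) ⊗ₜ[ℤ] x - c ⊗ₜ[ℤ] (s • x)}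

theorem balancedRel_toAddSubgroup (N : Type u) [AddCommGroup N] [Module S N] :
    (balancedRel R S C N).toAddSubgroup = AddSubgroup.closure
      {t | ∃ (c : C) (s : S) (x : N),
        t = (MulOpposite.op s • c) ⊗ₜ[ℤ] x - c ⊗ₜ[ℤ] (s • x)} := by
  apply le_antisymm
  · intro t ht
    refine Submodule.span_induction (fun y hy => AddSubgroup.subset_closure hy)
      (AddSubgroup.zero_mem _) (fun y z _ _ hy hz => AddSubgroup.add_mem _ hy hz) ?_ ht
    intro r y hy' hy
    clear hy'
    induction hy using AddSubgroup.closure_induction with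
    | mem y hy =>
      obtain ⟨c, s, x, rfl⟩ := hy
      refine AddSubgroup.subset_closure ⟨r • c, s, x, ?_⟩
      rw [smul_sub, TensorProduct.smul_tmul', TensorProduct.smul_tmul', smul_comm]
    | zero => rw [smul_zero]; exact AddSubgroup.zero_mem _
    | add y z _ _ hy hz => rw [smul_add]; exact AddSubgroup.add_mem _ hy hz
    | neg y _ hy => rw [smul_neg]; exact AddSubgroup.neg_mem _ hy
  · rw [AddSubgroup.closure_le]
    intro t ht
    exact Submodule.subset_span ht

/-- The tensor product `C ⊗_S N` of the `(R, S)`-bimodule `C` with the left `S`-module `N`,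
as a left `R`-module. -/
abbrev BalancedTensor (N : Type u) [AddCommGroup N] [Module S N] : Type u :=
  (C ⊗[ℤ] N) ⧸ balancedRel R S C N

/-- The class `c ⊗ x` in `C ⊗_S N`. -/
def BalancedTensor.tmul {N : Type u} [AddCommGroup N] [Module S N] (c : C) (x : N) :
    BalancedTensor R S C N :=
  (balancedRel R S C N).mkQ (c ⊗ₜ[ℤ] x)

/-- The `R`-linear map `C ⊗_S f : C ⊗_S N → C ⊗_S N'`, `c ⊗ x ↦ c ⊗ f x`. -/
def BalancedTensor.map {N N' : Type u} [AddCommGroup N] [Module S N] [AddCommGroup N'] [Module S N']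
    (f : N →ₗ[S] N') : BalancedTensor R S C N →ₗ[R] BalancedTensor R S C N' :=
  Submodule.mapQ _ _ (TensorProduct.AlgebraTensorModule.map (LinearMap.id : C →ₗ[R] C)
      (f.toAddMonoidHom.toIntLinearMap)) (by
    refine Submodule.span_le.2 ?_
    rintro _ ⟨c, s, x, rfl⟩
    refine Submodule.subset_span ⟨c, s, f x, ?_⟩
    simp)

/-- The functor `C ⊗_S - : Mod S ⥤ Mod R`. -/
def tensorFunctor : ModuleCat.{u} S ⥤ ModuleCat.{u} R where
  obj N := ModuleCat.of R (BalancedTensor R S C N)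
  map f := ModuleCat.ofHom (BalancedTensor.map R S C f.hom)
  map_id N := by
    apply ModuleCat.hom_ext
    apply Submodule.linearMap_qext
    apply TensorProduct.AlgebraTensorModule.ext
    intro c x
    rfl
  map_comp f g := by
    apply ModuleCat.hom_ext
    apply Submodule.linearMap_qext
    apply TensorProduct.AlgebraTensorModule.ext
    intro c x
    rfl

instance : (tensorFunctor R S C).Additive where
  map_add {N N' f g} := by
    apply ModuleCat.hom_ext
    apply Submodule.linearMap_qext
    apply TensorProduct.AlgebraTensorModule.ext
    intro c x
    change (balancedRel R S C N').mkQ (c ⊗ₜ[ℤ] (f.hom x + g.hom x)) =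
      (balancedRel R S C N').mkQ (c ⊗ₜ[ℤ] f.hom x) + (balancedRel R S C N').mkQ (c ⊗ₜ[ℤ] g.hom x)
    rw [TensorProduct.tmul_add, map_add]

/-- `Tor_i^S(C, N)`, the `i`-th left derived functor of `C ⊗_S -` at `N`
(with its natural left `R`-module structure). -/
noncomputable def tor (i : ℕ) (N : ModuleCat.{u} S) : ModuleCat.{u} R :=
  ((tensorFunctor R S C).leftDerived i).obj N

/-! ### The left `S`-module `M_* = Hom_R(C, M)` -/

/-- `M_* = Hom_R(C, M)`, as a type separate from `C →ₗ[R] M` so that it carries only the left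
`S`-module structure `(s f)(c) = f (c s)`. -/
def HomModule (M : Type u) [AddCommGroup M] [Module R M] : Type u := C →ₗ[R] M

instance (M : Type u) [AddCommGroup M] [Module R M] : AddCommGroup (HomModule R C M) :=
  inferInstanceAs (AddCommGroup (C →ₗ[R] M))

/-- The left `S`-module structure `(s f)(c) = f (c s)` on `Hom_R(C, M)`. -/
instance (M : Type u) [AddCommGroup M] [Module R M] : Module S (HomModule R C M) where
  smul s f := LinearMap.comp (show C →ₗ[R] M from f) (homothetyRight R S C s)
  one_smul f := by
    apply LinearMap.ext
    intro c
    change (show C →ₗ[R] M from f) (MulOpposite.op (1 : S) • c) = _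
    rw [MulOpposite.op_one, one_smul]
  mul_smul s t f := by
    apply LinearMap.ext
    intro c
    change (show C →ₗ[R] M from f) (MulOpposite.op (s * t) • c) =
      (show C →ₗ[R] M from f) (MulOpposite.op t • MulOpposite.op s • c)
    rw [MulOpposite.op_mul, mul_smul]
  smul_zero _ := rfl
  smul_add _ _ _ := rfl
  add_smul s t f := by
    apply LinearMap.ext
    intro c
    change (show C →ₗ[R] M from f) (MulOpposite.op (s + t) • c) =
      (show C →ₗ[R] M from f) (MulOpposite.op s • c) +
        (show C →ₗ[R] M from f) (MulOpposite.op t • c)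
    rw [MulOpposite.op_add, add_smul, map_add]
  zero_smul f := by
    apply LinearMap.ext
    intro c
    change (show C →ₗ[R] M from f) (MulOpposite.op (0 : S) • c) = 0
    rw [MulOpposite.op_zero, zero_smul, map_zero]

/-- The canonical valuation homomorphism `μ_N : N → Hom_R(C, C ⊗_S N)`, `μ_N(x)(c) = c ⊗ x`. -/
def valuation (N : Type u) [AddCommGroup N] [Module S N] :
    N →ₗ[S] HomModule R C (BalancedTensor R S C N) where
  toFun x := (show C →ₗ[R] BalancedTensor R S C N from
    { toFun := fun c => BalancedTensor.tmul R S C c x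
      map_add' := fun c c' => by
        unfold BalancedTensor.tmul
        rw [TensorProduct.add_tmul, map_add]
      map_smul' := fun r c => by
        unfold BalancedTensor.tmul
        rw [RingHom.id_apply, ← map_smul, TensorProduct.smul_tmul'] })
  map_add' x y := by
    apply LinearMap.ext
    intro c
    change (balancedRel R S C N).mkQ (c ⊗ₜ[ℤ] (x + y)) =
      (balancedRel R S C N).mkQ (c ⊗ₜ[ℤ] x) + (balancedRel R S C N).mkQ (c ⊗ₜ[ℤ] y)
    rw [TensorProduct.tmul_add, map_add]
  map_smul' s x := by
    apply LinearMap.ext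
    intro c
    change (balancedRel R S C N).mkQ (c ⊗ₜ[ℤ] (s • x)) =
      (balancedRel R S C N).mkQ ((MulOpposite.op s • c) ⊗ₜ[ℤ] x)
    refine Eq.symm ((Submodule.Quotient.eq _).2 ?_)
    exact Submodule.subset_span ⟨c, s, x, rfl⟩

/-! ### The Auslander class and the `C`-injective modules -/

/-- Membership in the Auslander class `𝒜_C(S)`. -/
structure InAuslanderClass (N : ModuleCat.{u} S) : Prop where
  /-- `Tor_i^S(C, N) = 0` for all `i ≥ 1`. -/
  tor_eq_zero : ∀ i : ℕ, 1 ≤ i → Subsingleton (tor R S C i N)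
  /-- `Ext_R^i(C, C ⊗_S N) = 0` for all `i ≥ 1`. -/
  ext_eq_zero : ∀ i : ℕ, 1 ≤ i →
    Subsingleton (Abelian.Ext (ModuleCat.of R C) (ModuleCat.of R (BalancedTensor R S C N)) i)
  /-- `μ_N` is an isomorphism. -/
  bijective_valuation : Function.Bijective (valuation R S C N)

/-- The Auslander class `𝒜_C(S)`, as a full subcategory of `Mod S`. -/
def auslanderClass : ObjectProperty (ModuleCat.{u} S) := fun N => InAuslanderClass R S C N

/-- The class `ℐ_C(S)` of `C`-injective modules: the `S`-modules isomorphic to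
`I_* = Hom_R(C, I)` for some injective left `R`-module `I`. -/
def cInjective : ObjectProperty (ModuleCat.{u} S) := fun N =>
  ∃ I : ModuleCat.{u} R, Injective I ∧ Nonempty (N ≃ₗ[S] HomModule R C I)

end Bimodule

/-! ### Projective dimension relative to a class of modules -/

section RelativeDimension

variable {S : Type u} [Ring S]

/-- There is an exact sequence `0 → X_n → ⋯ → X_1 → X_0 → N → 0` with all `X_i` in `𝒳`
(the sequence is continued to the left by zero modules `X_i`, `i > n`). -/
def HasResolutionOfLength (𝒳 : ObjectProperty (ModuleCat.{u} S)) (N : ModuleCat.{u} S) (n : ℕ) :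
    Prop :=
  ∃ (X : ℕ → ModuleCat.{u} S) (d : ∀ i : ℕ, X (i + 1) →ₗ[S] X i) (ε : X 0 →ₗ[S] N),
    (∀ i : ℕ, i ≤ n → 𝒳 (X i)) ∧ (∀ i : ℕ, n < i → Subsingleton (X i)) ∧
    Function.Surjective ε ∧ Function.Exact (d 0) ε ∧
    ∀ i : ℕ, Function.Exact (d (i + 1)) (d i)

/-- The `𝒳`-projective dimension of `N`: the least `n ≥ 0` such that there is an exact sequence
`0 → X_n → ⋯ → X_0 → N → 0` with all `X_i` in `𝒳`, and `⊤` (infinity) if there is none. -/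
noncomputable def relPd (𝒳 : ObjectProperty (ModuleCat.{u} S)) (N : ModuleCat.{u} S) : ℕ∞ :=
  ⨅ (n : ℕ) (_ : HasResolutionOfLength 𝒳 N n), (n : ℕ∞)

end RelativeDimension

end SemidualizingBimodule

/-! Write `X⁺ = Hom_ℤ(X, ℚ/ℤ)` for the character module. By `(C ⊗_S N)⁺ ≅ Hom_S(N, C⁺)`, the
vanishing of `Tor_i^S(C, N)` amounts to that of `Ext_S^i(N, C⁺)`, so all three conditions defining
the Auslander class pass along short exact sequences through long exact `Ext`-sequences and the
five lemma.

For an injective module `I`, the tensor evaluation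
`K ⊗_S Hom_R(C, I) → Hom_R(Hom_{S^op}(K, C), I)` is an isomorphism when the right `S`-module `K` is
finitely presented. Applied to `K = C` it gives `C ⊗_S Hom_R(C, I) ≅ I`, and applied to the syzygies
of `C` it gives `Tor_i^S(C, Hom_R(C, I)) = 0`; thus `Hom_R(C, I)` lies in the Auslander class.
Moreover, `N → Hom_R(C, E)`, with `E` an injective module containing `C ⊗_S N`, embeds every `N` of
the Auslander class in a `C`-injective module with cokernel in the Auslander class. The
approximations of a module of finite dimension are now those of Auslander and Buchweitz, constructed
by pushouts along such embeddings. -/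

namespace SemidualizingBimodule

section ShortExact

universe v

variable {A : Type*} [Ring A] {L M N : Type*} [AddCommGroup L] [Module A L]
  [AddCommGroup M] [Module A M] [AddCommGroup N] [Module A N]

/-- The sequence `0 → L → M → N → 0` of modules is exact; this is the unbundled form of
`CategoryTheory.ShortComplex.ShortExact`, in which the modules may live in different universes. -/
structure IsShortExact (f : L →ₗ[A] M) (g : M →ₗ[A] N) : Prop where
  injective : Function.Injective f
  exact : Function.Exact f g
  surjective : Function.Surjective g

theorem isShortExact_subtype_ker {g : M →ₗ[A] N} (hg : Function.Surjective g) :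
    IsShortExact (LinearMap.ker g).subtype g :=
  ⟨Submodule.injective_subtype _, LinearMap.exact_subtype_ker_map g, hg⟩

theorem exists_comp_eq_of_ker_le {X : Type*} [AddCommGroup X] [Module A X] {g : M →ₗ[A] N}
    (hg : Function.Surjective g) (p : M →ₗ[A] X) (h : LinearMap.ker g ≤ LinearMap.ker p) :
    ∃ q : N →ₗ[A] X, q ∘ₗ g = p :=
  ⟨(LinearMap.ker g).liftQ p h ∘ₗ (g.quotKerEquivOfSurjective hg).symm,
    LinearMap.ext fun x ↦ by simp only [LinearMap.comp_apply, LinearEquiv.coe_coe,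
      LinearMap.quotKerEquivOfSurjective_symm_apply, Submodule.liftQ_apply]⟩

theorem exists_comp_eq_of_range_le {X : Type*} [AddCommGroup X] [Module A X] {f : L →ₗ[A] M}
    (hf : Function.Injective f) (p : X →ₗ[A] M) (h : LinearMap.range p ≤ LinearMap.range f) :
    ∃ q : X →ₗ[A] L, f ∘ₗ q = p :=
  ⟨(LinearEquiv.ofInjective f hf).symm.toLinearMap ∘ₗ
    p.codRestrict (LinearMap.range f) fun x ↦ h ⟨x, rfl⟩, LinearMap.ext fun _ ↦
      congrArg Subtype.val ((LinearEquiv.ofInjective f hf).apply_symm_apply _)⟩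

variable (X : Type*) [AddCommGroup X] [Module A X] {f : L →ₗ[A] M} {g : M →ₗ[A] N}

theorem exact_precomp (hfg : Function.Exact f g) (hg : Function.Surjective g) :
    Function.Exact (fun φ : N →ₗ[A] X ↦ φ ∘ₗ g) fun φ ↦ φ ∘ₗ f := by
  refine fun φ ↦ ⟨fun hφ ↦ exists_comp_eq_of_ker_le hg φ ?_, ?_⟩
  · rw [hfg.linearMap_ker_eq, LinearMap.range_le_ker_iff]
    exact hφ
  · rintro ⟨ψ, rfl⟩
    exact LinearMap.ext fun x ↦ (congrArg ψ (hfg.apply_apply_eq_zero x)).trans (map_zero ψ)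

theorem exact_precomp_of_injective [Small.{v} A] (X : Type v) [AddCommGroup X] [Module A X]
    [Module.Injective A X] (hfg : Function.Exact f g) :
    Function.Exact (fun φ : N →ₗ[A] X ↦ φ ∘ₗ g) fun φ ↦ φ ∘ₗ f := by
  refine fun φ ↦ ⟨fun hφ ↦ ?_, ?_⟩
  · have hker : LinearMap.ker g.rangeRestrict ≤ LinearMap.ker φ := by
      rw [LinearMap.ker_rangeRestrict, hfg.linearMap_ker_eq, LinearMap.range_le_ker_iff]
      exact hφ
    obtain ⟨ψ, hψ⟩ := exists_comp_eq_of_ker_le g.surjective_rangeRestrict φ hker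
    obtain ⟨χ, rfl⟩ := Module.Injective.extension_property A X _ _ (LinearMap.range g).subtype
      (Submodule.injective_subtype _) ψ
    exact ⟨χ, hψ⟩
  · rintro ⟨ψ, rfl⟩
    exact LinearMap.ext fun x ↦ (congrArg ψ (hfg.apply_apply_eq_zero x)).trans (map_zero ψ)

theorem exact_postcomp (hf : Function.Injective f) (hfg : Function.Exact f g) :
    Function.Exact (fun φ : X →ₗ[A] L ↦ f ∘ₗ φ) fun φ ↦ g ∘ₗ φ := by
  refine fun φ ↦ ⟨fun hφ ↦ exists_comp_eq_of_range_le hf φ ?_, ?_⟩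
  · rw [← hfg.linearMap_ker_eq, LinearMap.range_le_ker_iff]
    exact hφ
  · rintro ⟨ψ, rfl⟩
    exact LinearMap.ext fun x ↦ hfg.apply_apply_eq_zero _

end ShortExact

section Ext

open Abelian

variable {A : Type u} [Ring A]

/-- `Ext^i_A(X, Y) = 0` for all `i ≥ 1`. -/
def ExtVanishes (X Y : ModuleCat.{u} A) : Prop :=
  ∀ i : ℕ, 1 ≤ i → Subsingleton (Ext X Y i)

theorem extVanishes_of_projective (X Y : ModuleCat.{u} A) [Projective X] : ExtVanishes X Y
  | i + 1, _ => Ext.subsingleton_of_projective X Y i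

theorem extVanishes_of_injective (X Y : ModuleCat.{u} A) [Injective Y] : ExtVanishes X Y
  | i + 1, _ => Ext.subsingleton_of_injective X Y i

variable {L M N : Type u} [AddCommGroup L] [Module A L] [AddCommGroup M] [Module A M]
  [AddCommGroup N] [Module A N] {f : L →ₗ[A] M} {g : M →ₗ[A] N}

/-- A short exact sequence of linear maps as a short complex in the category of modules. -/
abbrev IsShortExact.shortComplex (h : IsShortExact f g) : ShortComplex (ModuleCat.{u} A) :=
  ShortComplex.mk (ModuleCat.ofHom f) (ModuleCat.ofHom g)
    (ModuleCat.hom_ext h.exact.linearMap_comp_eq_zero)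

theorem IsShortExact.shortExact (h : IsShortExact f g) : h.shortComplex.ShortExact where
  exact := (ShortComplex.ShortExact.moduleCat_exact_iff_function_exact _).2 h.exact
  mono_f := (ModuleCat.mono_iff_injective _).2 h.injective
  epi_g := (ModuleCat.epi_iff_surjective _).2 h.surjective

namespace IsShortExact

variable (h : IsShortExact f g) {X : ModuleCat.{u} A}
include h

theorem surjective_comp_left_of_ext_one (hL : Subsingleton (Ext X (.of A L) 1)) :
    Function.Surjective fun ψ : X →ₗ[A] M ↦ g ∘ₗ ψ := by
  intro φ
  obtain ⟨x, hx⟩ := Ext.covariant_sequence_exact₃ X h.shortExact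
    (Ext.mk₀ (ModuleCat.ofHom φ : X ⟶ ModuleCat.of A N)) (zero_add 1) (hL.elim _ _)
  obtain ⟨ψ, rfl⟩ := (Ext.mk₀_bijective _ _).2 x
  rw [Ext.mk₀_comp_mk₀] at hx
  exact ⟨ψ.hom, congrArg ModuleCat.Hom.hom ((Ext.mk₀_bijective _ _).1 hx)⟩

theorem surjective_comp_right_of_ext_one (hN : Subsingleton (Ext (.of A N) X 1)) :
    Function.Surjective fun ψ : M →ₗ[A] X ↦ ψ ∘ₗ f := by
  intro φ
  obtain ⟨x, hx⟩ := Ext.contravariant_sequence_exact₁ h.shortExact X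
    (Ext.mk₀ (ModuleCat.ofHom φ : ModuleCat.of A L ⟶ X)) (add_zero 1) (hN.elim _ _)
  obtain ⟨ψ, rfl⟩ := (Ext.mk₀_bijective _ _).2 x
  rw [Ext.mk₀_comp_mk₀] at hx
  exact ⟨ψ.hom, congrArg ModuleCat.Hom.hom ((Ext.mk₀_bijective _ _).1 hx)⟩

theorem extVanishes_middle_right (hL : ExtVanishes X (.of A L)) (hN : ExtVanishes X (.of A N)) :
    ExtVanishes X (.of A M) := by
  intro i hi
  refine subsingleton_of_forall_eq 0 fun x ↦ ?_
  obtain ⟨y, rfl⟩ := Ext.covariant_sequence_exact₂ X h.shortExact x ((hN i hi).elim _ _)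
  rw [(hL i hi).elim y 0, Ext.zero_comp]

theorem extVanishes_cokernel_right (hL : ExtVanishes X (.of A L))
    (hM : ExtVanishes X (.of A M)) : ExtVanishes X (.of A N) := by
  intro i hi
  refine subsingleton_of_forall_eq 0 fun x ↦ ?_
  obtain ⟨y, rfl⟩ := Ext.covariant_sequence_exact₃ X h.shortExact x rfl
    ((hL (i + 1) (by lia)).elim _ _)
  rw [(hM i hi).elim y 0, Ext.zero_comp]

theorem ext_kernel_right {i : ℕ} (hN : Subsingleton (Ext X (.of A N) i))
    (hM : Subsingleton (Ext X (.of A M) (i + 1))) :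
    Subsingleton (Ext X (.of A L) (i + 1)) := by
  refine subsingleton_of_forall_eq 0 fun x ↦ ?_
  obtain ⟨y, rfl⟩ := Ext.covariant_sequence_exact₁ X h.shortExact x (hM.elim _ _) rfl
  rw [hN.elim y 0, Ext.zero_comp]

theorem ext_one_kernel_right (hlift : Function.Surjective fun ψ : X →ₗ[A] M ↦ g ∘ₗ ψ)
    (hM : Subsingleton (Ext X (.of A M) 1)) : Subsingleton (Ext X (.of A L) 1) := by
  refine subsingleton_of_forall_eq 0 fun x ↦ ?_
  obtain ⟨y, rfl⟩ := Ext.covariant_sequence_exact₁ X h.shortExact x (hM.elim _ _) (zero_add 1)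
  obtain ⟨φ, rfl⟩ := (Ext.mk₀_bijective _ _).2 y
  obtain ⟨ψ, hψ⟩ := hlift φ.hom
  have hφ : φ = ModuleCat.ofHom ψ ≫ h.shortComplex.g := ModuleCat.hom_ext hψ.symm
  rw [hφ, ← Ext.mk₀_comp_mk₀, Ext.comp_assoc_of_second_deg_zero,
    ShortComplex.ShortExact.comp_extClass, Ext.comp_zero]

theorem extVanishes_kernel_right (hlift : Function.Surjective fun ψ : X →ₗ[A] M ↦ g ∘ₗ ψ)
    (hM : ExtVanishes X (.of A M)) (hN : ExtVanishes X (.of A N)) : ExtVanishes X (.of A L)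
  | 1, hi => h.ext_one_kernel_right hlift (hM 1 hi)
  | i + 2, _ => h.ext_kernel_right (hN (i + 1) (by lia)) (hM (i + 2) (by lia))

theorem extVanishes_middle_left (hL : ExtVanishes (.of A L) X) (hN : ExtVanishes (.of A N) X) :
    ExtVanishes (.of A M) X := by
  intro i hi
  refine subsingleton_of_forall_eq 0 fun x ↦ ?_
  obtain ⟨y, rfl⟩ := Ext.contravariant_sequence_exact₂ h.shortExact X x ((hL i hi).elim _ _)
  rw [(hN i hi).elim y 0, Ext.comp_zero]

theorem extVanishes_kernel_left (hM : ExtVanishes (.of A M) X) (hN : ExtVanishes (.of A N) X) :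
    ExtVanishes (.of A L) X := by
  intro i hi
  refine subsingleton_of_forall_eq 0 fun x ↦ ?_
  obtain ⟨y, rfl⟩ := Ext.contravariant_sequence_exact₁ h.shortExact X x (add_comm 1 i)
    ((hN (i + 1) (by lia)).elim _ _)
  rw [(hM i hi).elim y 0, Ext.comp_zero]

theorem ext_cokernel_left {i : ℕ} (hL : Subsingleton (Ext (.of A L) X i))
    (hM : Subsingleton (Ext (.of A M) X (i + 1))) :
    Subsingleton (Ext (.of A N) X (i + 1)) := by
  refine subsingleton_of_forall_eq 0 fun x ↦ ?_
  obtain ⟨y, rfl⟩ := Ext.contravariant_sequence_exact₃ h.shortExact X x (hM.elim _ _)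
    (add_comm 1 i)
  rw [hL.elim y 0, Ext.comp_zero]

theorem ext_one_cokernel_left (hext : Function.Surjective fun ψ : M →ₗ[A] X ↦ ψ ∘ₗ f)
    (hM : Subsingleton (Ext (.of A M) X 1)) : Subsingleton (Ext (.of A N) X 1) := by
  refine subsingleton_of_forall_eq 0 fun x ↦ ?_
  obtain ⟨y, rfl⟩ := Ext.contravariant_sequence_exact₃ h.shortExact X x (hM.elim _ _) (add_zero 1)
  obtain ⟨φ, rfl⟩ := (Ext.mk₀_bijective _ _).2 y
  obtain ⟨ψ, hψ⟩ := hext φ.hom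
  have hφ : φ = h.shortComplex.f ≫ ModuleCat.ofHom ψ := ModuleCat.hom_ext hψ.symm
  rw [hφ, ← Ext.mk₀_comp_mk₀, ShortComplex.ShortExact.extClass_comp_assoc]

theorem extVanishes_cokernel_left (hext : Function.Surjective fun ψ : M →ₗ[A] X ↦ ψ ∘ₗ f)
    (hL : ExtVanishes (.of A L) X) (hM : ExtVanishes (.of A M) X) : ExtVanishes (.of A N) X
  | 1, hi => h.ext_one_cokernel_left hext (hM 1 hi)
  | i + 2, _ => h.ext_cokernel_left (hL (i + 1) (by lia)) (hM (i + 2) (by lia))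

end IsShortExact

end Ext

section Characters

theorem exact_dual_iff {A B D : Type*} [AddCommGroup A] [AddCommGroup B] [AddCommGroup D]
    {f : A →ₗ[ℤ] B} {g : B →ₗ[ℤ] D} :
    Function.Exact (CharacterModule.dual g) (CharacterModule.dual f) ↔ Function.Exact f g := by
  constructor
  · intro h
    have hgf : g ∘ₗ f = 0 := LinearMap.ext fun a ↦ CharacterModule.eq_zero_of_character_apply
      fun χ ↦ DFunLike.congr_fun (h.apply_apply_eq_zero χ) a
    refine LinearMap.exact_iff.2 (le_antisymm (fun b hb ↦ ?_) (LinearMap.range_le_ker_iff.2 hgf))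
    refine (Submodule.Quotient.mk_eq_zero _).1
      (CharacterModule.eq_zero_of_character_apply fun χ ↦ ?_)
    let q := (LinearMap.range f).mkQ
    have hqf : CharacterModule.dual f (CharacterModule.dual q χ) = 0 := by
      ext a
      exact (congrArg χ ((Submodule.Quotient.mk_eq_zero _).2 (LinearMap.mem_range_self f a))).trans
        (map_zero χ)
    obtain ⟨ψ, hψ⟩ := (h _).1 hqf
    exact (DFunLike.congr_fun hψ b).symm.trans ((congrArg ψ hb).trans (map_zero ψ))
  · intro h χ
    have : Module.Injective ℤ (AddCircle (1 : ℚ)) := (Module.Baer.of_divisible _).injective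
    constructor
    · intro hχ
      obtain ⟨ψ, hψ⟩ := (exact_precomp_of_injective (AddCircle (1 : ℚ)) h
        (χ : B →+ _).toIntLinearMap).1 (LinearMap.ext fun a ↦ DFunLike.congr_fun hχ a)
      exact ⟨ψ.toAddMonoidHom, congrArg LinearMap.toAddMonoidHom hψ⟩
    · rintro ⟨ψ, rfl⟩
      ext a
      exact (congrArg ψ (h.apply_apply_eq_zero a)).trans (map_zero ψ)

end Characters

section RightCharacterModule

/-- The character group `Hom_ℤ(M, ℚ/ℤ)` of a right `S`-module `M`, as a type separate from
`CharacterModule M` so that it carries only the left `S`-module structure `(s φ)(m) = φ (m s)`. -/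
def RightCharacterModule (_S M : Type*) [AddCommGroup M] : Type _ :=
  CharacterModule M

namespace RightCharacterModule

variable {S M : Type*} [AddCommGroup M]

instance : AddCommGroup (RightCharacterModule S M) :=
  inferInstanceAs (AddCommGroup (CharacterModule M))

instance : FunLike (RightCharacterModule S M) M (AddCircle (1 : ℚ)) :=
  inferInstanceAs (FunLike (CharacterModule M) M (AddCircle (1 : ℚ)))

instance : LinearMapClass (RightCharacterModule S M) ℤ M (AddCircle (1 : ℚ)) :=
  inferInstanceAs (LinearMapClass (CharacterModule M) ℤ M (AddCircle (1 : ℚ)))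

@[ext] theorem ext {φ ψ : RightCharacterModule S M} (h : ∀ m, φ m = ψ m) : φ = ψ :=
  DFunLike.ext _ _ h

@[simp] theorem add_apply (φ ψ : RightCharacterModule S M) (m : M) : (φ + ψ) m = φ m + ψ m := rfl

variable [Ring S] [Module Sᵐᵒᵖ M]

instance : Module S (RightCharacterModule S M) where
  smul s φ := AddMonoidHom.comp (show M →+ AddCircle (1 : ℚ) from φ)
    (DistribSMul.toAddMonoidHom M (MulOpposite.op s))
  one_smul φ := ext fun m ↦ congrArg φ (one_smul Sᵐᵒᵖ m)
  mul_smul s t φ := ext fun m ↦ congrArg φ (mul_smul (MulOpposite.op t) (MulOpposite.op s) m)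
  smul_zero _ := rfl
  smul_add _ _ _ := rfl
  add_smul s t φ := ext fun m ↦
    (congrArg φ (add_smul (MulOpposite.op s) (MulOpposite.op t) m)).trans (map_add φ _ _)
  zero_smul φ := ext fun m ↦ (congrArg φ (zero_smul Sᵐᵒᵖ m)).trans (map_zero φ)

@[simp] theorem smul_apply (s : S) (φ : RightCharacterModule S M) (m : M) :
    (s • φ) m = φ (MulOpposite.op s • m) := rfl

variable {L N : Type*} [AddCommGroup L] [Module Sᵐᵒᵖ L] [AddCommGroup N] [Module Sᵐᵒᵖ N]

/-- Restriction of characters along a map of right modules: the contravariant functor `(-)⁺`. -/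
def map (f : L →ₗ[Sᵐᵒᵖ] M) : RightCharacterModule S M →ₗ[S] RightCharacterModule S L where
  toFun := CharacterModule.dual (f.restrictScalars ℤ)
  map_add' := map_add (CharacterModule.dual (f.restrictScalars ℤ))
  map_smul' s φ := ext fun x ↦ congrArg φ (map_smul f (MulOpposite.op s) x).symm

@[simp] theorem map_apply (f : L →ₗ[Sᵐᵒᵖ] M) (φ : RightCharacterModule S M) (x : L) :
    map f φ x = φ (f x) := rfl

theorem isShortExact_map {f : L →ₗ[Sᵐᵒᵖ] M} {g : M →ₗ[Sᵐᵒᵖ] N} (h : IsShortExact f g) :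
    IsShortExact (map (S := S) g) (map f) where
  injective := CharacterModule.dual_injective_of_surjective (g.restrictScalars ℤ) h.surjective
  exact := (exact_dual_iff (f := f.restrictScalars ℤ) (g := g.restrictScalars ℤ)).2 h.exact
  surjective := CharacterModule.dual_surjective_of_injective (f.restrictScalars ℤ) h.injective

theorem finsupp_ext {ι : Type*} {φ ψ : RightCharacterModule S (ι →₀ Sᵐᵒᵖ)}
    (h : ∀ i s, φ (Finsupp.single i s) = ψ (Finsupp.single i s)) : φ = ψ :=
  Finsupp.addHom_ext (f := (show (ι →₀ Sᵐᵒᵖ) →+ AddCircle (1 : ℚ) from φ)) h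

/-- The character of the free right module on `ι` with prescribed values on the summands. -/
noncomputable def finsuppLift {ι : Type*} (F : ι → Sᵐᵒᵖ →+ AddCircle (1 : ℚ)) :
    RightCharacterModule S (ι →₀ Sᵐᵒᵖ) :=
  Finsupp.liftAddHom F

@[simp] theorem finsuppLift_single {ι : Type*} (F : ι → Sᵐᵒᵖ →+ AddCircle (1 : ℚ)) (i : ι)
    (s : Sᵐᵒᵖ) : finsuppLift F (Finsupp.single i s) = F i s :=
  Finsupp.liftAddHom_apply_single F i s

/-- The `S`-linear map into the characters of a free right module that corresponds to a family of
characters. -/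
noncomputable def ofCharacters {ι Y : Type*} [AddCommGroup Y] [Module S Y]
    (β : ι → CharacterModule Y) : Y →ₗ[S] RightCharacterModule S (ι →₀ Sᵐᵒᵖ) where
  toFun y := finsuppLift fun i ↦ AddMonoidHom.mk' (fun s ↦ β i (s.unop • y)) fun s t ↦ by
    rw [MulOpposite.unop_add, add_smul, map_add]
  map_add' y z := finsupp_ext fun i s ↦ by simp
  map_smul' t y := finsupp_ext fun i s ↦ by
    simp [-Finsupp.single_mul, mul_smul]

@[simp] theorem ofCharacters_apply_single {ι Y : Type*} [AddCommGroup Y] [Module S Y]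
    (β : ι → CharacterModule Y) (y : Y) (i : ι) (s : Sᵐᵒᵖ) :
    ofCharacters β y (Finsupp.single i s) = β i (s.unop • y) :=
  finsuppLift_single _ i s

theorem injective_of_projective (P : Type*) [AddCommGroup P] [Module Sᵐᵒᵖ P]
    [Module.Projective Sᵐᵒᵖ P] : Module.Injective S (RightCharacterModule S P) := by
  obtain ⟨σ, hσ⟩ := Module.projective_def'.1 ‹Module.Projective Sᵐᵒᵖ P›
  refine ⟨fun X Y _ _ _ _ i hi φ ↦ ?_⟩
  have extend (p : P) : ∃ β : CharacterModule Y, ∀ x, β (i x) = φ x p := by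
    obtain ⟨β, hβ⟩ := CharacterModule.dual_surjective_of_injective (i.restrictScalars ℤ) hi
      (AddMonoidHom.mk' (fun x ↦ φ x p) fun x y ↦ by simp)
    exact ⟨β, DFunLike.congr_fun hβ⟩
  choose β hβ using extend
  have hβi (x : X) : ofCharacters β (i x) = map (Finsupp.linearCombination Sᵐᵒᵖ id) (φ x) :=
    finsupp_ext fun p s ↦ by
      rw [ofCharacters_apply_single, ← map_smul i, hβ, map_smul, smul_apply, map_apply,
        Finsupp.linearCombination_single, MulOpposite.op_unop, id]
  refine ⟨map σ ∘ₗ ofCharacters β, fun x ↦ ext fun p ↦ ?_⟩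
  rw [LinearMap.comp_apply, hβi]
  exact congrArg (φ x) (LinearMap.congr_fun hσ p)

end RightCharacterModule

end RightCharacterModule

section Tensor

variable {R S : Type u} [Ring R] [Ring S]
variable {C : Type u} [AddCommGroup C] [Module R C] [Module Sᵐᵒᵖ C]
variable {L M N : Type u} [AddCommGroup L] [Module S L] [AddCommGroup M] [Module S M]
  [AddCommGroup N] [Module S N]

namespace BalancedTensor

@[elab_as_elim]
theorem induction {p : BalancedTensor R S C N → Prop} (t : BalancedTensor R S C N)
    (tmul : ∀ c x, p (tmul R S C c x)) (add : ∀ y z, p y → p z → p (y + z)) : p t := by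
  obtain ⟨t, rfl⟩ := Submodule.mkQ_surjective _ t
  induction t using TensorProduct.induction_on with
  | zero => simpa only [BalancedTensor.tmul, TensorProduct.zero_tmul] using tmul 0 0
  | tmul c x => exact tmul c x
  | add y z hy hz => rw [map_add]; exact add _ _ hy hz

theorem tmul_smul (c : C) (s : S) (x : N) :
    tmul R S C c (s • x) = tmul R S C (MulOpposite.op s • c) x :=
  Eq.symm ((Submodule.Quotient.eq _).2 (Submodule.subset_span ⟨c, s, x, rfl⟩))

theorem tmul_add (c : C) (x y : N) : tmul R S C c (x + y) = tmul R S C c x + tmul R S C c y := by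
  simp only [tmul, TensorProduct.tmul_add, map_add]

theorem add_tmul (c d : C) (x : N) : tmul R S C (c + d) x = tmul R S C c x + tmul R S C d x := by
  simp only [tmul, TensorProduct.add_tmul, map_add]

theorem smul_tmul (r : R) (c : C) (x : N) : tmul R S C (r • c) x = r • tmul R S C c x := by
  simp only [tmul, ← map_smul, TensorProduct.smul_tmul']

theorem addHom_ext {A : Type*} [AddCommGroup A] {φ ψ : BalancedTensor R S C N →+ A}
    (h : ∀ c x, φ (tmul R S C c x) = ψ (tmul R S C c x)) : φ = ψ := by
  ext t
  induction t using induction with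
  | tmul c x => exact h c x
  | add y z hy hz => rw [map_add, map_add, hy, hz]

theorem linearMap_ext {A : Type*} [AddCommGroup A] [Module R A]
    {φ ψ : BalancedTensor R S C N →ₗ[R] A}
    (h : ∀ c x, φ (tmul R S C c x) = ψ (tmul R S C c x)) : φ = ψ :=
  LinearMap.toAddMonoidHom_injective (addHom_ext h)

theorem map_surjective {g : M →ₗ[S] N} (hg : Function.Surjective g) :
    Function.Surjective (map R S C g) := by
  rw [← LinearMap.range_eq_top, eq_top_iff]
  rintro t -
  induction t using induction with
  | tmul c x =>
    obtain ⟨y, rfl⟩ := hg x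
    exact ⟨tmul R S C c y, rfl⟩
  | add y z hy hz => exact add_mem hy hz

variable [SMulCommClass R Sᵐᵒᵖ C]

variable (R) in
/-- The additive map on `C ⊗_S N` induced by a biadditive map which is balanced over `S`. -/
noncomputable def lift {A : Type*} [AddCommGroup A] (b : C →+ N →+ A)
    (hb : ∀ (c : C) (s : S) (x : N), b (MulOpposite.op s • c) x = b c (s • x)) :
    BalancedTensor R S C N →+ A :=
  QuotientAddGroup.lift (balancedRel R S C N).toAddSubgroup
    (TensorProduct.liftAddHom b fun n c x ↦ by simp) <| by
      rw [balancedRel_toAddSubgroup, AddSubgroup.closure_le]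
      rintro _ ⟨c, s, x, rfl⟩
      rw [SetLike.mem_coe, AddMonoidHom.mem_ker, map_sub, TensorProduct.liftAddHom_tmul,
        TensorProduct.liftAddHom_tmul, hb, sub_self]

variable (R S C N) in
/-- The adjunction `(C ⊗_S N)⁺ ≃ Hom_S(N, C⁺)`. -/
noncomputable def characterEquiv :
    CharacterModule (BalancedTensor R S C N) ≃+ (N →ₗ[S] RightCharacterModule S C) where
  toFun φ :=
    { toFun := fun x ↦ AddMonoidHom.mk' (fun c ↦ φ (tmul R S C c x)) fun c d ↦ by
        rw [add_tmul, map_add]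
      map_add' := fun x y ↦ RightCharacterModule.ext fun c ↦
        (congrArg φ (tmul_add c x y)).trans (map_add φ _ _)
      map_smul' := fun s x ↦ RightCharacterModule.ext fun c ↦ congrArg φ (tmul_smul c s x) }
  invFun f := lift R (AddMonoidHom.mk' (fun c ↦ AddMonoidHom.mk' (fun x ↦ f x c) fun x y ↦ by simp)
    fun c d ↦ by ext x; simp) fun c s x ↦ by simp
  left_inv φ := addHom_ext fun c x ↦ rfl
  right_inv f := rfl
  map_add' φ ψ := rfl

theorem map_injective_iff {f : M →ₗ[S] N} : Function.Injective (map R S C f) ↔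
    Function.Surjective fun h : N →ₗ[S] RightCharacterModule S C ↦ h ∘ₗ f := by
  refine (CharacterModule.dual_surjective_iff_injective
    (f := (map R S C f).restrictScalars ℤ)).symm.trans ?_
  rw [← (characterEquiv R S C M).comp_surjective]
  exact (characterEquiv R S C N).surjective_comp
    (fun h : N →ₗ[S] RightCharacterModule S C ↦ h ∘ₗ f)

theorem map_exact_iff {f : L →ₗ[S] M} {g : M →ₗ[S] N} :
    Function.Exact (map R S C f) (map R S C g) ↔
      Function.Exact (fun h : N →ₗ[S] RightCharacterModule S C ↦ h ∘ₗ g) fun h ↦ h ∘ₗ f := by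
  refine (exact_dual_iff (f := (map R S C f).restrictScalars ℤ)
    (g := (map R S C g).restrictScalars ℤ)).symm.trans ?_
  exact (Function.Exact.iff_of_ladder_addEquiv
    (f₁₂ := (CharacterModule.dual ((map R S C g).restrictScalars ℤ)).toAddMonoidHom)
    (f₂₃ := (CharacterModule.dual ((map R S C f).restrictScalars ℤ)).toAddMonoidHom)
    (g₁₂ := (g.lcomp ℤ (RightCharacterModule S C)).toAddMonoidHom)
    (g₂₃ := (f.lcomp ℤ (RightCharacterModule S C)).toAddMonoidHom)
    (characterEquiv R S C N) (characterEquiv R S C M) (characterEquiv R S C L) rfl rfl).symm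

theorem map_exact {f : L →ₗ[S] M} {g : M →ₗ[S] N} (hfg : Function.Exact f g)
    (hg : Function.Surjective g) : Function.Exact (map R S C f) (map R S C g) :=
  map_exact_iff.2 (exact_precomp _ hfg hg)

theorem isShortExact_map {f : L →ₗ[S] M} {g : M →ₗ[S] N} (h : IsShortExact f g)
    (hf : Function.Surjective fun φ : M →ₗ[S] RightCharacterModule S C ↦ φ ∘ₗ f) :
    IsShortExact (map R S C f) (map R S C g) :=
  ⟨map_injective_iff.2 hf, map_exact h.exact h.surjective, map_surjective h.surjective⟩

end BalancedTensor

end Tensor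

section Tor

variable {R S : Type u} [Ring R] [Ring S]
variable {C : Type u} [AddCommGroup C] [Module R C] [Module Sᵐᵒᵖ C]

theorem tor_subsingleton_iff_exact {N : ModuleCat.{u} S} (P : ProjectiveResolution N) (i : ℕ) :
    Subsingleton (tor R S C (i + 1) N) ↔
      Function.Exact (BalancedTensor.map R S C (P.complex.d (i + 2) (i + 1)).hom)
        (BalancedTensor.map R S C (P.complex.d (i + 1) i).hom) := by
  rw [tor, ← ModuleCat.isZero_iff_subsingleton,
    (P.isoLeftDerivedObj (tensorFunctor R S C) (i + 1)).isZero_iff]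
  refine (HomologicalComplex.exactAt_iff_isZero_homology
    (((tensorFunctor R S C).mapHomologicalComplex _).obj P.complex) (i + 1)).symm.trans ?_
  rw [HomologicalComplex.exactAt_iff' _ (i + 2) (i + 1) i (by simp) (by simp),
    ShortComplex.ShortExact.moduleCat_exact_iff_function_exact]
  rfl

theorem ext_subsingleton_iff_exact {A : Type u} [Ring A] {M : ModuleCat.{u} A}
    (P : ProjectiveResolution M) (X : ModuleCat.{u} A) (i : ℕ) :
    Subsingleton (Abelian.Ext M X (i + 1)) ↔
      Function.Exact (fun h : P.complex.X i →ₗ[A] X ↦ h ∘ₗ (P.complex.d (i + 1) i).hom)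
        fun h ↦ h ∘ₗ (P.complex.d (i + 2) (i + 1)).hom := by
  constructor
  · intro H p
    constructor
    · intro hp
      have hp' : P.complex.d (i + 2) (i + 1) ≫ ModuleCat.ofHom p = 0 := ModuleCat.hom_ext hp
      obtain ⟨q, hq⟩ := (P.extMk_eq_zero_iff _ (i + 2) rfl hp' i rfl).1 (H.elim _ _)
      exact ⟨q.hom, congrArg ModuleCat.Hom.hom hq⟩
    · rintro ⟨q, rfl⟩
      exact (LinearMap.comp_assoc _ _ q).trans (by
        rw [← ModuleCat.hom_comp, P.complex.d_comp_d, ModuleCat.hom_zero, LinearMap.comp_zero])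
  · intro H
    refine subsingleton_of_forall_eq 0 fun x ↦ ?_
    obtain ⟨p, hp, rfl⟩ := P.extMk_surjective x (i + 2) rfl
    obtain ⟨q, hq⟩ := (H p.hom).1 (congrArg ModuleCat.Hom.hom hp)
    exact (P.extMk_eq_zero_iff p (i + 2) rfl hp i rfl).2 ⟨ModuleCat.ofHom q, ModuleCat.hom_ext hq⟩

variable [SMulCommClass R Sᵐᵒᵖ C]

theorem tor_subsingleton_iff_ext (N : ModuleCat.{u} S) (i : ℕ) :
    Subsingleton (tor R S C (i + 1) N) ↔
      Subsingleton (Abelian.Ext N (.of S (RightCharacterModule S C)) (i + 1)) := by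
  rw [tor_subsingleton_iff_exact (projectiveResolution N),
    ext_subsingleton_iff_exact (projectiveResolution N), BalancedTensor.map_exact_iff]

theorem inAuslanderClass_iff {N : ModuleCat.{u} S} : InAuslanderClass R S C N ↔
    ExtVanishes N (.of S (RightCharacterModule S C)) ∧
      ExtVanishes (.of R C) (.of R (BalancedTensor R S C N)) ∧
      Function.Bijective (valuation R S C N) := by
  have tor_iff : (∀ i : ℕ, 1 ≤ i → Subsingleton (tor R S C i N)) ↔
      ExtVanishes N (.of S (RightCharacterModule S C)) := by
    refine forall_congr' fun i ↦ ⟨fun h hi ↦ ?_, fun h hi ↦ ?_⟩ <;>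
      obtain ⟨i, rfl⟩ := Nat.exists_eq_add_of_le' hi
    exacts [(tor_subsingleton_iff_ext N i).1 (h hi), (tor_subsingleton_iff_ext N i).2 (h hi)]
  exact ⟨fun h ↦ ⟨tor_iff.1 h.tor_eq_zero, h.ext_eq_zero, h.bijective_valuation⟩,
    fun h ↦ ⟨tor_iff.2 h.1, h.2.1, h.2.2⟩⟩

end Tor

section ShortFive

variable {A : Type*} [Ring A] {L M N L' M' N' : Type*}
  [AddCommGroup L] [Module A L] [AddCommGroup M] [Module A M] [AddCommGroup N] [Module A N]
  [AddCommGroup L'] [Module A L'] [AddCommGroup M'] [Module A M'] [AddCommGroup N'] [Module A N']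
  {f : L →ₗ[A] M} {g : M →ₗ[A] N} {f' : L' →ₗ[A] M'} {g' : M' →ₗ[A] N'}
  {α : L →ₗ[A] L'} {β : M →ₗ[A] M'} {γ : N →ₗ[A] N'}

namespace IsShortExact

variable (h : IsShortExact f g) (h' : IsShortExact f' g')
  (hf : f' ∘ₗ α = β ∘ₗ f) (hg : g' ∘ₗ β = γ ∘ₗ g)
include h h' hf hg

theorem bijective_left (hβ : Function.Bijective β) (hγ : Function.Injective γ) :
    Function.Bijective α :=
  AddMonoidHom.bijective_of_bijective_of_injective_of_left_exact
    f.toAddMonoidHom g.toAddMonoidHom f'.toAddMonoidHom g'.toAddMonoidHom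
    α.toAddMonoidHom β.toAddMonoidHom γ.toAddMonoidHom
    (congrArg LinearMap.toAddMonoidHom hf) (congrArg LinearMap.toAddMonoidHom hg)
    h.exact h'.exact hβ hγ h.injective h'.injective

theorem bijective_right (hα : Function.Surjective α) (hβ : Function.Bijective β) :
    Function.Bijective γ :=
  AddMonoidHom.bijective_of_surjective_of_bijective_of_right_exact
    f.toAddMonoidHom g.toAddMonoidHom f'.toAddMonoidHom g'.toAddMonoidHom
    α.toAddMonoidHom β.toAddMonoidHom γ.toAddMonoidHom
    (congrArg LinearMap.toAddMonoidHom hf) (congrArg LinearMap.toAddMonoidHom hg)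
    h.exact h'.exact hα hβ h.surjective h'.surjective

theorem bijective_middle (hα : Function.Bijective α) (hγ : Function.Bijective γ) :
    Function.Bijective β :=
  AddMonoidHom.bijective_of_surjective_of_bijective_of_bijective_of_injective
    (0 : Unit →ₗ[A] L).toAddMonoidHom f.toAddMonoidHom g.toAddMonoidHom
    (0 : N →ₗ[A] Unit).toAddMonoidHom (0 : Unit →ₗ[A] L').toAddMonoidHom f'.toAddMonoidHom
    g'.toAddMonoidHom (0 : N' →ₗ[A] Unit).toAddMonoidHom
    (.id Unit) α.toAddMonoidHom β.toAddMonoidHom γ.toAddMonoidHom (.id Unit)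
    (AddMonoidHom.ext fun _ ↦ (map_zero α).symm) (congrArg LinearMap.toAddMonoidHom hf)
    (congrArg LinearMap.toAddMonoidHom hg) rfl
    ((LinearMap.exact_zero_iff_injective Unit f).2 h.injective) h.exact
    ((LinearMap.exact_zero_iff_surjective Unit g).2 h.surjective)
    ((LinearMap.exact_zero_iff_injective Unit f').2 h'.injective) h'.exact
    ((LinearMap.exact_zero_iff_surjective Unit g').2 h'.surjective)
    Function.surjective_id hα hγ Function.injective_id

end IsShortExact

end ShortFive

section HomModule

variable {R S : Type u} [Ring R] [Ring S]
variable {C : Type u} [AddCommGroup C] [Module R C] [Module Sᵐᵒᵖ C] [SMulCommClass R Sᵐᵒᵖ C]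
variable {L M N : Type u} [AddCommGroup L] [Module R L] [AddCommGroup M] [Module R M]
  [AddCommGroup N] [Module R N]

namespace HomModule

instance : FunLike (HomModule R C M) C M := inferInstanceAs (FunLike (C →ₗ[R] M) C M)

instance : LinearMapClass (HomModule R C M) R C M :=
  inferInstanceAs (LinearMapClass (C →ₗ[R] M) R C M)

@[ext] theorem ext {φ ψ : HomModule R C M} (h : ∀ c, φ c = ψ c) : φ = ψ :=
  DFunLike.ext _ _ h

/-- Composition with `f`, the action of the functor `Hom_R(C, -)` on morphisms. -/
def map (f : M →ₗ[R] N) : HomModule R C M →ₗ[S] HomModule R C N where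
  toFun φ := f ∘ₗ (show C →ₗ[R] M from φ)
  map_add' _ _ := LinearMap.comp_add _ _ f
  map_smul' _ _ := rfl

theorem map_injective {f : M →ₗ[R] N} (hf : Function.Injective f) :
    Function.Injective (map (S := S) (C := C) f) :=
  fun _ _ h ↦ ext fun c ↦ hf (DFunLike.congr_fun h c)

theorem map_exact {f : L →ₗ[R] M} {g : M →ₗ[R] N} (hf : Function.Injective f)
    (hfg : Function.Exact f g) :
    Function.Exact (map (S := S) (C := C) f) (map (S := S) (C := C) g) :=
  exact_postcomp C hf hfg

theorem isShortExact_map {f : L →ₗ[R] M} {g : M →ₗ[R] N} (h : IsShortExact f g)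
    (hL : Subsingleton (Abelian.Ext (ModuleCat.of R C) (ModuleCat.of R L) 1)) :
    IsShortExact (map (S := S) (C := C) f) (map (S := S) (C := C) g) :=
  ⟨map_injective h.injective, map_exact h.injective h.exact,
    h.surjective_comp_left_of_ext_one (X := .of R C) hL⟩

end HomModule

end HomModule

section TwoOfThree

variable {R S : Type u} [Ring R] [Ring S]
variable {C : Type u} [AddCommGroup C] [Module R C] [Module Sᵐᵒᵖ C] [SMulCommClass R Sᵐᵒᵖ C]
variable {L M N : ModuleCat.{u} S} {f : L →ₗ[S] M} {g : M →ₗ[S] N}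

theorem valuation_comp (f : L →ₗ[S] M) :
    HomModule.map (BalancedTensor.map R S C f) ∘ₗ valuation R S C L =
      valuation R S C M ∘ₗ f := rfl

namespace InAuslanderClass

theorem isShortExact_map (hN : InAuslanderClass R S C N) (h : IsShortExact f g) :
    IsShortExact (BalancedTensor.map R S C f) (BalancedTensor.map R S C g) :=
  BalancedTensor.isShortExact_map h
    (h.surjective_comp_right_of_ext_one ((inAuslanderClass_iff.1 hN).1 1 le_rfl))

theorem extension (h : IsShortExact f g) (hL : InAuslanderClass R S C L)
    (hN : InAuslanderClass R S C N) : InAuslanderClass R S C M := by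
  have hT := hN.isShortExact_map h
  obtain ⟨tor_L, ext_L, val_L⟩ := inAuslanderClass_iff.1 hL
  obtain ⟨tor_N, ext_N, val_N⟩ := inAuslanderClass_iff.1 hN
  refine inAuslanderClass_iff.2
    ⟨h.extVanishes_middle_left tor_L tor_N, hT.extVanishes_middle_right ext_L ext_N, ?_⟩
  exact h.bijective_middle (HomModule.isShortExact_map hT (ext_L 1 le_rfl))
    (valuation_comp f) (valuation_comp g) val_L val_N

theorem kernel (h : IsShortExact f g) (hM : InAuslanderClass R S C M)
    (hN : InAuslanderClass R S C N) : InAuslanderClass R S C L := by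
  have hT := hN.isShortExact_map h
  obtain ⟨tor_M, ext_M, val_M⟩ := inAuslanderClass_iff.1 hM
  obtain ⟨tor_N, ext_N, val_N⟩ := inAuslanderClass_iff.1 hN
  have lift : Function.Surjective fun ψ : C →ₗ[R] BalancedTensor R S C M ↦
      BalancedTensor.map R S C g ∘ₗ ψ :=
    .of_comp (g := valuation R S C M) (val_N.2.comp h.surjective)
  have ext_L := hT.extVanishes_kernel_right (X := .of R C) lift ext_M ext_N
  refine inAuslanderClass_iff.2 ⟨h.extVanishes_kernel_left tor_M tor_N, ext_L, ?_⟩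
  exact h.bijective_left (HomModule.isShortExact_map hT (ext_L 1 le_rfl))
    (valuation_comp f) (valuation_comp g) val_M val_N.1

theorem cokernel (h : IsShortExact f g) (hL : InAuslanderClass R S C L)
    (hM : InAuslanderClass R S C M) (hf : Function.Injective (BalancedTensor.map R S C f)) :
    InAuslanderClass R S C N := by
  have extend := (BalancedTensor.map_injective_iff (R := R)).1 hf
  have hT := BalancedTensor.isShortExact_map (R := R) h extend
  obtain ⟨tor_L, ext_L, val_L⟩ := inAuslanderClass_iff.1 hL
  obtain ⟨tor_M, ext_M, val_M⟩ := inAuslanderClass_iff.1 hM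
  refine inAuslanderClass_iff.2
    ⟨h.extVanishes_cokernel_left extend tor_L tor_M, hT.extVanishes_cokernel_right ext_L ext_M, ?_⟩
  exact h.bijective_right (HomModule.isShortExact_map hT (ext_L 1 le_rfl))
    (valuation_comp f) (valuation_comp g) val_L.2 val_M

end InAuslanderClass

end TwoOfThree

section TensorEvaluation

theorem exists_dual_basis (A P : Type*) [Ring A] [AddCommGroup P] [Module A P] [Module.Finite A P]
    [Module.Projective A P] :
    ∃ (n : ℕ) (x : Fin n → P) (g : Fin n → P →ₗ[A] A), ∀ p, ∑ i, g i p • x i = p := by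
  obtain ⟨n, f, g, -, -, hfg⟩ := Module.Finite.exists_comp_eq_id_of_projective A P
  refine ⟨n, fun i ↦ f (Pi.single i 1), fun i ↦ LinearMap.proj i ∘ₗ g, fun p ↦ ?_⟩
  calc ∑ i, g p i • f (Pi.single i 1) = f (g p) := by
        rw [← LinearMap.sum_single_apply (fun _ ↦ A) (g p), map_sum]
        simp [← map_smul, ← Pi.single_smul]
    _ = p := LinearMap.congr_fun hfg p

variable {R S : Type u} [Ring R] [Ring S]
variable {C : Type u} [AddCommGroup C] [Module R C] [Module Sᵐᵒᵖ C] [SMulCommClass R Sᵐᵒᵖ C]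
variable {I : Type u} [AddCommGroup I] [Module R I]
variable {K P Q : Type*} [AddCommGroup K] [Module Sᵐᵒᵖ K] [AddCommGroup P] [Module Sᵐᵒᵖ P]
  [AddCommGroup Q] [Module Sᵐᵒᵖ Q]

local instance : SMulCommClass Sᵐᵒᵖ R C := .symm R Sᵐᵒᵖ C

variable (S) in
/-- The tensor evaluation map `Hom_R(C, I) × K → Hom_R(Hom_{S^op}(K, C), I)`,
`(d, k) ↦ (h ↦ d (h k))`, of a right `S`-module `K`, as a biadditive map. -/
def tensorEvaluation : HomModule R C I →+ K →+ (K →ₗ[Sᵐᵒᵖ] C) →ₗ[R] I :=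
  AddMonoidHom.mk' (fun d ↦ AddMonoidHom.mk'
    (fun k ↦ (show C →ₗ[R] I from d) ∘ₗ LinearMap.applyₗ' R k) fun k l ↦ by
      rw [map_add, LinearMap.comp_add]) fun _ _ ↦ rfl

@[simp] theorem tensorEvaluation_apply (d : HomModule R C I) (k : K) (h : K →ₗ[Sᵐᵒᵖ] C) :
    tensorEvaluation S d k h = d (h k) := rfl

theorem tensorEvaluation_smul (s : S) (d : HomModule R C I) (k : K) :
    tensorEvaluation S (s • d) k = tensorEvaluation S d (MulOpposite.op s • k) :=
  LinearMap.ext fun h ↦ congrArg d (map_smul h (MulOpposite.op s) k).symm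

variable (R S C I K) in
/-- The character dual of the tensor evaluation map
`K ⊗_S Hom_R(C, I) → Hom_R(Hom_{S^op}(K, C), I)`, where `(K ⊗_S Hom_R(C, I))⁺` is written as
`Hom_S(Hom_R(C, I), K⁺)`. -/
def dualTensorEvaluation :
    CharacterModule ((K →ₗ[Sᵐᵒᵖ] C) →ₗ[R] I) →+
      (HomModule R C I →ₗ[S] RightCharacterModule S K) where
  toFun Λ :=
    { toFun := fun d ↦ AddMonoidHom.comp Λ (tensorEvaluation S d)
      map_add' := fun d e ↦ RightCharacterModule.ext fun k ↦
        map_add Λ (tensorEvaluation S d k) (tensorEvaluation S e k)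
      map_smul' := fun s d ↦ RightCharacterModule.ext fun k ↦
        congrArg Λ (tensorEvaluation_smul s d k) }
  map_zero' := rfl
  map_add' _ _ := rfl

/-- The map `Hom_R(Hom_{S^op}(P, C), I) → Hom_R(C, I)` induced by a functional `g` on `P` via
`c ↦ (p ↦ c (g p))`. -/
def contract (g : P →ₗ[Sᵐᵒᵖ] Sᵐᵒᵖ) : ((P →ₗ[Sᵐᵒᵖ] C) →ₗ[R] I) →+ HomModule R C I :=
  AddMonoidHom.mk' (fun F ↦ F ∘ₗ
    { toFun := fun c ↦ g.smulRight c
      map_add' := fun c d ↦ LinearMap.ext fun p ↦ smul_add (g p) c d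
      map_smul' := fun r c ↦ LinearMap.ext fun p ↦ (smul_comm r (g p) c).symm }) fun _ _ ↦ rfl

@[simp] theorem contract_apply (g : P →ₗ[Sᵐᵒᵖ] Sᵐᵒᵖ) (F : (P →ₗ[Sᵐᵒᵖ] C) →ₗ[R] I) (c : C) :
    contract (S := S) g F c = F (g.smulRight c) := rfl

theorem contract_tensorEvaluation (g : P →ₗ[Sᵐᵒᵖ] Sᵐᵒᵖ) (d : HomModule R C I) (p : P) :
    contract g (tensorEvaluation S d p) = (g p).unop • d := rfl

theorem sum_tensorEvaluation_contract {ι : Type*} [Fintype ι] {x : ι → P}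
    {g : ι → P →ₗ[Sᵐᵒᵖ] Sᵐᵒᵖ} (hxg : ∀ p, ∑ i, g i p • x i = p) (F : (P →ₗ[Sᵐᵒᵖ] C) →ₗ[R] I) :
    ∑ i, tensorEvaluation S (contract (g i) F) (x i) = F := by
  ext h
  have hh : ∑ i, (g i).smulRight (h (x i)) = h := LinearMap.ext fun p ↦ by
    conv_rhs => rw [← hxg p]
    simp
  conv_rhs => rw [← hh]
  simp

theorem dualTensorEvaluation_bijective_of_projective [Module.Finite Sᵐᵒᵖ P]
    [Module.Projective Sᵐᵒᵖ P] : Function.Bijective (dualTensorEvaluation R S C I P) := by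
  obtain ⟨n, x, g, hxg⟩ := exists_dual_basis Sᵐᵒᵖ P
  constructor
  · rw [injective_iff_map_eq_zero]
    intro Λ hΛ
    ext F
    rw [← sum_tensorEvaluation_contract hxg F, map_sum]
    exact Finset.sum_eq_zero fun i _ ↦
      DFunLike.congr_fun (LinearMap.congr_fun hΛ (contract (g i) F)) (x i)
  · intro φ
    refine ⟨AddMonoidHom.mk' (fun F ↦ ∑ i, φ (contract (g i) F) (x i)) fun F G ↦ ?_, ?_⟩
    · simp [Finset.sum_add_distrib]
    · ext d p
      change ∑ i, φ (contract (g i) (tensorEvaluation S d p)) (x i) = φ d p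
      calc ∑ i, φ (contract (g i) (tensorEvaluation S d p)) (x i)
          = ∑ i, φ d (g i p • x i) := by simp [contract_tensorEvaluation]
        _ = φ d p := by rw [← map_sum, hxg]

variable (R C I) in
/-- The map `Hom_R(Hom_{S^op}(P, C), I)⁺ → Hom_R(Hom_{S^op}(K, C), I)⁺` induced by `j : K → P`. -/
def dualTensorMap (j : K →ₗ[Sᵐᵒᵖ] P) :
    CharacterModule ((P →ₗ[Sᵐᵒᵖ] C) →ₗ[R] I) →ₗ[ℤ] CharacterModule ((K →ₗ[Sᵐᵒᵖ] C) →ₗ[R] I) :=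
  CharacterModule.dual (LinearMap.lcomp ℤ I (LinearMap.lcomp R C j))

theorem dualTensorEvaluation_dualTensorMap (j : K →ₗ[Sᵐᵒᵖ] P)
    (Λ : CharacterModule ((P →ₗ[Sᵐᵒᵖ] C) →ₗ[R] I)) :
    dualTensorEvaluation R S C I K (dualTensorMap R C I j Λ) =
      RightCharacterModule.map j ∘ₗ dualTensorEvaluation R S C I P Λ := rfl

theorem dualTensorMap_surjective {j : K →ₗ[Sᵐᵒᵖ] P}
    (hj : Function.Surjective fun h : P →ₗ[Sᵐᵒᵖ] C ↦ h ∘ₗ j) :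
    Function.Surjective (dualTensorMap R C I j) :=
  CharacterModule.dual_surjective_of_injective _ <|
    LinearMap.lcomp_injective_of_surjective (LinearMap.lcomp R C j) hj

variable [Module.Injective R I]

theorem dualTensorMap_injective {p : P →ₗ[Sᵐᵒᵖ] Q} (hp : Function.Surjective p) :
    Function.Injective (dualTensorMap R C I p) :=
  CharacterModule.dual_injective_of_surjective _ <|
    Module.Injective.extension_property R I _ _ (LinearMap.lcomp R C p)
      (LinearMap.lcomp_injective_of_surjective p hp)

theorem dualTensorMap_exact {j : K →ₗ[Sᵐᵒᵖ] P} {p : P →ₗ[Sᵐᵒᵖ] Q} (h : IsShortExact j p) :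
    Function.Exact (dualTensorMap R C I p) (dualTensorMap R C I j) :=
  exact_dual_iff.2 <| exact_precomp_of_injective (f := LinearMap.lcomp R C p)
    (g := LinearMap.lcomp R C j) I (exact_precomp C h.exact h.surjective)

theorem dualTensorEvaluation_injective_of_finite [Module.Finite Sᵐᵒᵖ K] :
    Function.Injective (dualTensorEvaluation R S C I K) := by
  obtain ⟨n, p, hp⟩ := Module.Finite.exists_fin' Sᵐᵒᵖ K
  refine Function.Injective.of_comp (f := fun φ ↦ RightCharacterModule.map p ∘ₗ φ) ?_
  exact dualTensorEvaluation_bijective_of_projective.1.comp (dualTensorMap_injective hp)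

theorem dualTensorEvaluation_bijective {j : K →ₗ[Sᵐᵒᵖ] P} {p : P →ₗ[Sᵐᵒᵖ] Q}
    (h : IsShortExact j p) [Module.Finite Sᵐᵒᵖ K] [Module.Finite Sᵐᵒᵖ P]
    [Module.Projective Sᵐᵒᵖ P] : Function.Bijective (dualTensorEvaluation R S C I Q) := by
  have hchar := RightCharacterModule.isShortExact_map h
  exact AddMonoidHom.bijective_of_bijective_of_injective_of_left_exact
    (dualTensorMap R C I p).toAddMonoidHom (dualTensorMap R C I j).toAddMonoidHom
    (AddMonoidHom.mk' (fun φ ↦ RightCharacterModule.map p ∘ₗ φ)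
      fun φ ψ ↦ LinearMap.comp_add φ ψ _)
    (AddMonoidHom.mk' (fun φ ↦ RightCharacterModule.map j ∘ₗ φ)
      fun φ ψ ↦ LinearMap.comp_add φ ψ _)
    (dualTensorEvaluation R S C I Q) (dualTensorEvaluation R S C I P)
    (dualTensorEvaluation R S C I K) rfl rfl (dualTensorMap_exact h)
    (exact_postcomp _ hchar.injective hchar.exact) dualTensorEvaluation_bijective_of_projective
    dualTensorEvaluation_injective_of_finite (dualTensorMap_injective h.surjective)
    hchar.injective.injective_linearMapComp_left

end TensorEvaluation

section TypeFP

variable {A : Type u} [Ring A]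

/-- The module `M` is of type `FP_n`: it has a partial projective resolution
`P_{n-1} → ⋯ → P_0 → M → 0` by finitely generated modules whose `n`-th syzygy is finitely
generated. -/
def IsTypeFP : ℕ → ModuleCat.{u} A → Prop
  | 0, M => Module.Finite A M
  | n + 1, M => ∃ (K P : ModuleCat.{u} A) (j : K →ₗ[A] P) (p : P →ₗ[A] M),
      Module.Finite A P ∧ Module.Projective A P ∧ IsShortExact j p ∧ IsTypeFP n K

theorem IsTypeFP.finite : ∀ {n : ℕ} {M : ModuleCat.{u} A}, IsTypeFP n M → Module.Finite A M
  | 0, _, h => h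
  | _ + 1, _, ⟨_, _, _, p, _, _, hp, _⟩ => .of_surjective p hp.surjective

theorem isShortExact_subtype_range {L M N : Type*} [AddCommGroup L] [Module A L] [AddCommGroup M]
    [Module A M] [AddCommGroup N] [Module A N] {f : L →ₗ[A] M} {g : M →ₗ[A] N}
    (hfg : Function.Exact f g) (hg : Function.Surjective g) :
    IsShortExact (LinearMap.range f).subtype g :=
  ⟨Submodule.injective_subtype _,
    LinearMap.exact_iff.2 (by rw [Submodule.range_subtype, hfg.linearMap_ker_eq]), hg⟩

theorem HasDegreewiseFiniteProjectiveResolution.isTypeFP {M : ModuleCat.{u} A}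
    (h : HasDegreewiseFiniteProjectiveResolution M) (n : ℕ) : IsTypeFP n M := by
  obtain ⟨P, hfin⟩ := h
  have hproj (i : ℕ) : Module.Projective A (P.complex.X i) :=
    (IsProjective.iff_projective _).2 (P.projective i)
  have exact_d (i : ℕ) : Function.Exact (P.complex.d (i + 2) (i + 1)).hom
      (P.complex.d (i + 1) i).hom.rangeRestrict := by
    rw [LinearMap.exact_iff, LinearMap.ker_rangeRestrict]
    exact ((ShortComplex.ShortExact.moduleCat_exact_iff_function_exact _).1
      ((HomologicalComplex.exactAt_iff' _ (i + 2) (i + 1) i (by simp) (by simp)).1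
        (P.complex_exactAt_succ i))).linearMap_ker_eq
  have isTypeFP_range (n : ℕ) : ∀ i : ℕ,
      IsTypeFP n (.of A (LinearMap.range (P.complex.d (i + 1) i).hom)) := by
    induction n with
    | zero => exact fun i ↦ Module.Finite.range _
    | succ n ih => exact fun i ↦ ⟨_, P.complex.X (i + 1), _, _, hfin _, hproj _,
        isShortExact_subtype_range (exact_d i) (LinearMap.surjective_rangeRestrict _), ih (i + 1)⟩
  have surjective_π : Function.Surjective (P.π.f 0).hom :=
    (ModuleCat.epi_iff_surjective _).1 inferInstance
  have exact_π : Function.Exact (P.complex.d 1 0).hom (P.π.f 0).hom :=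
    (ShortComplex.ShortExact.moduleCat_exact_iff_function_exact _).1 P.exact₀
  cases n with
  | zero => exact Module.Finite.of_surjective _ surjective_π
  | succ n => exact ⟨_, P.complex.X 0, _, _, hfin 0, hproj 0,
      isShortExact_subtype_range exact_π surjective_π, isTypeFP_range n 0⟩

end TypeFP

section HomIntoInjective

variable {R S : Type u} [Ring R] [Ring S]
variable {C : Type u} [AddCommGroup C] [Module R C] [Module Sᵐᵒᵖ C] [SMulCommClass R Sᵐᵒᵖ C]
variable {I : Type u} [AddCommGroup I] [Module R I]

theorem surjective_map_comp {K P : Type*} [AddCommGroup K] [Module Sᵐᵒᵖ K] [AddCommGroup P]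
    [Module Sᵐᵒᵖ P] {j : K →ₗ[Sᵐᵒᵖ] P}
    (hj : Function.Surjective fun h : P →ₗ[Sᵐᵒᵖ] C ↦ h ∘ₗ j)
    (hK : Function.Surjective (dualTensorEvaluation R S C I K)) :
    Function.Surjective fun ψ : HomModule R C I →ₗ[S] RightCharacterModule S P ↦
      RightCharacterModule.map j ∘ₗ ψ := by
  refine .of_comp (g := dualTensorEvaluation R S C I P) ?_
  simpa only [Function.comp_def, dualTensorEvaluation_dualTensorMap] using
    hK.comp (dualTensorMap_surjective (I := I) hj)

variable [Module.Injective R I]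

theorem ext_homModule_rightCharacterModule (i : ℕ) : ∀ {K : ModuleCat.{u} Sᵐᵒᵖ},
    IsTypeFP (i + 2) K → ExtVanishes K (.of Sᵐᵒᵖ C) →
    Subsingleton (Abelian.Ext (ModuleCat.of S (HomModule R C I))
      (ModuleCat.of S (RightCharacterModule S K)) (i + 1)) := by
  induction i with
  | zero =>
    rintro K ⟨K', P, j, p, _, hP, h, K'', P', j', p', _, _, h', hK''⟩ hext
    have := hK''.finite
    have : Injective (ModuleCat.of S (RightCharacterModule S P)) :=
      (Module.injective_iff_injective_object _ _).1
        (RightCharacterModule.injective_of_projective P)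
    exact (RightCharacterModule.isShortExact_map h).ext_one_kernel_right
      (surjective_map_comp (h.surjective_comp_right_of_ext_one (hext 1 le_rfl))
        (dualTensorEvaluation_bijective h').2)
      (Abelian.Ext.subsingleton_of_injective _ _ 0)
  | succ i ih =>
    rintro K ⟨K', P, j, p, _, hP, h, hK'⟩ hext
    have : Injective (ModuleCat.of S (RightCharacterModule S P)) :=
      (Module.injective_iff_injective_object _ _).1
        (RightCharacterModule.injective_of_projective P)
    have : Projective (ModuleCat.of Sᵐᵒᵖ P) := (IsProjective.iff_projective _).1 hP
    exact (RightCharacterModule.isShortExact_map h).ext_kernel_right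
      (ih hK' (h.extVanishes_kernel_left (extVanishes_of_projective _ _) hext))
      (Abelian.Ext.subsingleton_of_injective _ _ (i + 1))

end HomIntoInjective

section Evaluation

variable (R S C I : Type u) [Ring R] [Ring S] [AddCommGroup C] [Module R C] [Module Sᵐᵒᵖ C]
  [SMulCommClass R Sᵐᵒᵖ C] [AddCommGroup I] [Module R I]

/-- The evaluation map `C ⊗_S Hom_R(C, I) → I`, the counit of the adjunction between
`C ⊗_S -` and `Hom_R(C, -)`. -/
noncomputable def evaluation : BalancedTensor R S C (HomModule R C I) →ₗ[R] I where
  __ := BalancedTensor.lift (S := S) R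
    (AddMonoidHom.mk' (fun c ↦ AddMonoidHom.mk' (fun d : HomModule R C I ↦ d c) fun _ _ ↦ rfl)
      fun c c' ↦ AddMonoidHom.ext fun d ↦ map_add d c c') fun _ _ _ ↦ rfl
  map_smul' r t := by
    change BalancedTensor.lift R _ _ (r • t) = r • BalancedTensor.lift R _ _ t
    induction t using BalancedTensor.induction with
    | tmul c d =>
      rw [← BalancedTensor.smul_tmul]
      exact map_smul d r c
    | add y z hy hz => rw [smul_add, map_add, map_add, hy, hz, smul_add]

variable {R S C}

local instance : SMulCommClass Sᵐᵒᵖ R C := .symm R Sᵐᵒᵖ C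

theorem bijective_apply_id (hC : Function.Bijective (homothetyLeft R S C)) :
    Function.Bijective (LinearMap.applyₗ' (M₂ := I) (R := R) ℤ (LinearMap.id : C →ₗ[Sᵐᵒᵖ] C)) := by
  let e : R ≃ₗ[R] (C →ₗ[Sᵐᵒᵖ] C) :=
    .ofBijective (LinearMap.toSpanSingleton R _ LinearMap.id) hC
  have he : e 1 = LinearMap.id := one_smul R _
  refine ⟨fun F G (hFG : F LinearMap.id = G LinearMap.id) ↦ ?_,
    fun x ↦ ⟨LinearMap.toSpanSingleton R I x ∘ₗ e.symm.toLinearMap, ?_⟩⟩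
  · refine (LinearMap.cancel_right e.surjective).1 (LinearMap.ext_ring ?_)
    simpa [he] using hFG
  · simp [← he]

theorem evaluation_bijective [Module.Injective R I] (hfin : IsTypeFP 1 (.of Sᵐᵒᵖ C))
    (hC : Function.Bijective (homothetyLeft R S C)) :
    Function.Bijective (evaluation R S C I) := by
  obtain ⟨K, P, j, p, _, _, h, hK⟩ := hfin
  have : Module.Finite Sᵐᵒᵖ K := hK
  rw [← LinearMap.coe_restrictScalars ℤ, ← CharacterModule.dual_bijective_iff_bijective]
  refine ((BalancedTensor.characterEquiv R S C (HomModule R C I)).bijective.of_comp_iff' _).1 ?_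
  exact (dualTensorEvaluation_bijective (R := R) (C := C) (I := I) h).comp
    (CharacterModule.dual_bijective_iff_bijective.2 (bijective_apply_id I hC))

end Evaluation

section Semidualizing

variable {R S : Type u} [Ring R] [Ring S]
variable {C : Type u} [AddCommGroup C] [Module R C] [Module Sᵐᵒᵖ C] [SMulCommClass R Sᵐᵒᵖ C]

namespace InAuslanderClass

theorem of_subsingleton (N : ModuleCat.{u} S) [Subsingleton N] : InAuslanderClass R S C N := by
  have : Subsingleton (BalancedTensor R S C N) := subsingleton_of_forall_eq 0 fun t ↦ by
    induction t using BalancedTensor.induction with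
    | tmul c x =>
      rw [Subsingleton.elim x 0]
      exact DFunLike.congr_fun (map_zero (valuation R S C N)) c
    | add y z hy hz => rw [hy, hz, add_zero]
  have : Projective N := (ModuleCat.isZero_of_subsingleton N).projective
  have : Injective (ModuleCat.of R (BalancedTensor R S C N)) :=
    (ModuleCat.isZero_of_subsingleton _).injective
  exact inAuslanderClass_iff.2 ⟨extVanishes_of_projective _ _, extVanishes_of_injective _ _,
    Function.injective_of_subsingleton _, fun φ ↦ ⟨0, HomModule.ext fun _ ↦ Subsingleton.elim _ _⟩⟩

theorem of_linearEquiv {N N' : ModuleCat.{u} S} (e : N ≃ₗ[S] N') (h : InAuslanderClass R S C N) :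
    InAuslanderClass R S C N' :=
  kernel (N := .of S PUnit) (f := e.symm.toLinearMap) (g := 0)
    ⟨e.symm.injective, (LinearMap.exact_zero_iff_surjective _ _).2 e.symm.surjective,
      Function.surjective_to_subsingleton _⟩ h (of_subsingleton _)

end InAuslanderClass

variable (R S C) in
/-- The part of `IsSemidualizing` that makes the `C`-injective modules a cogenerator of the
Auslander class: `C` has a degreewise finite projective resolution over `S^op`, the homothety map
`R → Hom_{S^op}(C, C)` is bijective, and `Ext_{S^op}^i(C, C) = 0` for `i ≥ 1`. -/
structure IsRightSemidualizing : Prop where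
  finite_right : HasDegreewiseFiniteProjectiveResolution (ModuleCat.of Sᵐᵒᵖ C)
  bijective_homothetyLeft : Function.Bijective (homothetyLeft R S C)
  ext_right : ExtVanishes (.of Sᵐᵒᵖ C) (.of Sᵐᵒᵖ C)

theorem IsSemidualizing.isRightSemidualizing (hC : IsSemidualizing R S C) :
    IsRightSemidualizing R S C where
  __ := hC

namespace IsRightSemidualizing

variable (hC : IsRightSemidualizing R S C)
include hC

theorem inAuslanderClass_homModule (I : Type u) [AddCommGroup I] [Module R I]
    [Module.Injective R I] : InAuslanderClass R S C (.of S (HomModule R C I)) := by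
  have bijective_ev := evaluation_bijective I (hC.finite_right.isTypeFP 1)
    hC.bijective_homothetyLeft
  have : Injective (ModuleCat.of R I) := (Module.injective_iff_injective_object R I).1 ‹_›
  have : Injective (ModuleCat.of R (BalancedTensor R S C (HomModule R C I))) :=
    .of_iso (LinearEquiv.ofBijective _ bijective_ev).toModuleIso.symm this
  -- The triangle identity of the adjunction between `C ⊗_S -` and `Hom_R(C, -)`.
  have triangle : Function.LeftInverse (HomModule.map (S := S) (evaluation R S C I))
      (valuation R S C (HomModule R C I)) := fun _ ↦ rfl
  exact inAuslanderClass_iff.2 ⟨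
    fun
    | i + 1, _ => ext_homModule_rightCharacterModule i (hC.finite_right.isTypeFP _) hC.ext_right,
    extVanishes_of_injective _ _, triangle.injective,
    (triangle.rightInverse_of_injective (HomModule.map_injective bijective_ev.1)).surjective⟩

theorem cInjective_le_auslanderClass : cInjective R S C ≤ auslanderClass R S C := by
  rintro N ⟨I, hI, ⟨e⟩⟩
  have := (Module.injective_iff_injective_object R I).2 hI
  exact (hC.inAuslanderClass_homModule I).of_linearEquiv e.symm

theorem exists_isShortExact_cInjective {N : ModuleCat.{u} S} (hN : auslanderClass R S C N) :
    ∃ (U V : ModuleCat.{u} S) (f : N →ₗ[S] U) (g : U →ₗ[S] V),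
      IsShortExact f g ∧ cInjective R S C U ∧ auslanderClass R S C V := by
  let T := ModuleCat.of R (BalancedTensor R S C N)
  let I := Injective.under T
  let ι : T →ₗ[R] I := (Injective.ι T).hom
  have hι : Function.Injective ι := (ModuleCat.mono_iff_injective _).1 (Injective.ι_mono T)
  have hI : Injective I := inferInstance
  have : Module.Injective R I := (Module.injective_iff_injective_object R I).2 hI
  let j : N →ₗ[S] HomModule R C I := HomModule.map ι ∘ₗ valuation R S C N
  have hj : Function.Injective j :=
    (HomModule.map_injective (S := S) hι).comp hN.bijective_valuation.1
  have evaluation_map_j : evaluation R S C I ∘ₗ BalancedTensor.map R S C j = ι :=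
    BalancedTensor.linearMap_ext fun _ _ ↦ rfl
  have injective_map_j : Function.Injective (BalancedTensor.map R S C j) :=
    .of_comp (f := evaluation R S C I) (by rwa [← LinearMap.coe_comp, evaluation_map_j])
  have h : IsShortExact j (LinearMap.range j).mkQ :=
    ⟨hj, LinearMap.exact_map_mkQ_range j, Submodule.mkQ_surjective _⟩
  exact ⟨.of S (HomModule R C I), .of S (HomModule R C I ⧸ LinearMap.range j), j, _, h,
    ⟨I, hI, ⟨.refl _ _⟩⟩,
    InAuslanderClass.cokernel (M := .of S (HomModule R C I)) h hN
      (hC.inAuslanderClass_homModule I) injective_map_j⟩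

end IsRightSemidualizing

end Semidualizing

section Diagrams

variable {A : Type*} [Ring A] {K X Y Q N : Type*} [AddCommGroup K] [Module A K]
  [AddCommGroup X] [Module A X] [AddCommGroup Y] [Module A Y] [AddCommGroup Q] [Module A Q]
  [AddCommGroup N] [Module A N]

/-- The square with sides `i : K → X`, `a : K → Y`, `v : X → Q` and `u : Y → Q` is a pushout of
modules; `CategoryTheory.IsPushout` expressed on elements, as exactness of
`K → X × Y → Q → 0`. -/
structure IsPushoutSquare (i : K →ₗ[A] X) (a : K →ₗ[A] Y) (v : X →ₗ[A] Q) (u : Y →ₗ[A] Q) :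
    Prop where
  eq_iff (x : X) (y : Y) : v x = u y ↔ ∃ k, i k = x ∧ a k = y
  exists_add (q : Q) : ∃ x y, v x + u y = q

theorem exists_isPushoutSquare {X Y : Type u} [AddCommGroup X] [Module A X] [AddCommGroup Y]
    [Module A Y] (i : K →ₗ[A] X) (a : K →ₗ[A] Y) :
    ∃ (Q : ModuleCat.{u} A) (v : X →ₗ[A] Q) (u : Y →ₗ[A] Q), IsPushoutSquare i a v u := by
  let W : Submodule A (X × Y) := LinearMap.range (i.prod (-a))
  refine ⟨.of A ((X × Y) ⧸ W), W.mkQ ∘ₗ .inl A X Y, W.mkQ ∘ₗ .inr A X Y, fun x y ↦ ?_, fun q ↦ ?_⟩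
  · refine (Submodule.Quotient.eq W).trans (exists_congr fun k ↦ ?_)
    simp [Prod.ext_iff]
  · obtain ⟨⟨x, y⟩, rfl⟩ := W.mkQ_surjective q
    exact ⟨x, y, (map_add W.mkQ _ _).symm.trans (by simp)⟩

namespace IsPushoutSquare

variable {i : K →ₗ[A] X} {a : K →ₗ[A] Y} {v : X →ₗ[A] Q} {u : Y →ₗ[A] Q}

theorem symm (h : IsPushoutSquare i a v u) : IsPushoutSquare a i u v where
  eq_iff y x := by simp only [eq_comm (a := u y), h.eq_iff, and_comm]
  exists_add q := by
    obtain ⟨x, y, rfl⟩ := h.exists_add q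
    exact ⟨y, x, add_comm _ _⟩

theorem comm (h : IsPushoutSquare i a v u) (k : K) : v (i k) = u (a k) :=
  (h.eq_iff _ _).2 ⟨k, rfl, rfl⟩

theorem exists_isShortExact (h : IsPushoutSquare i a v u) {p : X →ₗ[A] N}
    (hp : IsShortExact i p) : ∃ q : Q →ₗ[A] N, IsShortExact u q := by
  have surjective_coprod : Function.Surjective (v.coprod u) := fun t ↦ by
    obtain ⟨x, y, rfl⟩ := h.exists_add t
    exact ⟨(x, y), rfl⟩
  obtain ⟨q, hq⟩ := exists_comp_eq_of_ker_le surjective_coprod (p ∘ₗ .fst A X Y) fun ⟨x, y⟩ hxy ↦ by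
    obtain ⟨k, rfl, -⟩ := (h.eq_iff x (-y)).1 <| by
      rw [map_neg]
      exact eq_neg_of_add_eq_zero_left hxy
    exact hp.exact.apply_apply_eq_zero k
  have q_add (x : X) (y : Y) : q (v x + u y) = p x := LinearMap.congr_fun hq (x, y)
  have q_v (x : X) : q (v x) = p x := by simpa using q_add x 0
  have q_u (y : Y) : q (u y) = 0 := by simpa using q_add 0 y
  refine ⟨q, (injective_iff_map_eq_zero u).2 fun y hy ↦ ?_, fun t ↦ ⟨fun ht ↦ ?_, ?_⟩, fun n ↦ ?_⟩
  · obtain ⟨k, hk, rfl⟩ := (h.eq_iff 0 y).1 (by rw [map_zero, hy])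
    rw [(map_eq_zero_iff i hp.injective).1 hk, map_zero]
  · obtain ⟨x, y, rfl⟩ := h.exists_add t
    obtain ⟨k, rfl⟩ := (hp.exact x).1 (by rwa [← q_add x y])
    exact ⟨a k + y, by rw [map_add, h.comm]⟩
  · rintro ⟨y, rfl⟩
    exact q_u y
  · obtain ⟨x, rfl⟩ := hp.surjective n
    exact ⟨v x, q_v x⟩

theorem isShortExact_comp (h : IsPushoutSquare i a v u) {j : N →ₗ[A] K} (hj : IsShortExact j i)
    (ha : Function.Injective a) : IsShortExact (a ∘ₗ j) u where
  injective := ha.comp hj.injective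
  exact y := by
    have : u y = 0 ↔ ∃ k, i k = 0 ∧ a k = y := by rw [← h.eq_iff, map_zero, eq_comm]
    simp only [this, hj.exact _]
    exact ⟨fun ⟨k, ⟨n, hn⟩, hk⟩ ↦ ⟨n, (congrArg a hn).trans hk⟩, fun ⟨n, hn⟩ ↦ ⟨j n, ⟨n, rfl⟩, hn⟩⟩
  surjective q := by
    obtain ⟨x, y, rfl⟩ := h.exists_add q
    obtain ⟨k, rfl⟩ := hj.surjective x
    exact ⟨a k + y, by rw [map_add, h.comm]⟩

end IsPushoutSquare

theorem IsShortExact.exists_isShortExact_ker_comp {f : N →ₗ[A] Y} {g : Y →ₗ[A] Q}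
    {i : K →ₗ[A] X} {p : X →ₗ[A] Y} (h : IsShortExact f g) (hp : IsShortExact i p) :
    ∃ (j : K →ₗ[A] LinearMap.ker (g ∘ₗ p)) (π : LinearMap.ker (g ∘ₗ p) →ₗ[A] N),
      IsShortExact j π := by
  let P := LinearMap.ker (g ∘ₗ p)
  let j : K →ₗ[A] P := i.codRestrict P fun k ↦ by simp [P, hp.exact.apply_apply_eq_zero]
  obtain ⟨π, hπ⟩ := exists_comp_eq_of_range_le h.injective (p ∘ₗ P.subtype) <| by
    rintro _ ⟨x, rfl⟩
    exact (h.exact _).1 x.2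
  have f_π (x : P) : f (π x) = p x := LinearMap.congr_fun hπ x
  refine ⟨j, π, fun k l hkl ↦ hp.injective (congrArg Subtype.val hkl), fun x ↦ ?_, fun n ↦ ?_⟩
  · rw [← map_eq_zero_iff f h.injective, f_π, hp.exact]
    exact exists_congr fun k ↦ ⟨fun hk ↦ Subtype.ext hk, congrArg Subtype.val⟩
  · obtain ⟨x, hx⟩ := hp.surjective (f n)
    exact ⟨⟨x, by simp [hx, h.exact.apply_apply_eq_zero]⟩, h.injective ((f_π _).trans hx)⟩

end Diagrams

section RelativeDimension

variable {S : Type u} [Ring S] {𝒳 𝒴 : ObjectProperty (ModuleCat.{u} S)} {N : ModuleCat.{u} S}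

theorem HasResolutionOfLength.mono {n : ℕ} (h : 𝒳 ≤ 𝒴) (hN : HasResolutionOfLength 𝒳 N n) :
    HasResolutionOfLength 𝒴 N n :=
  have ⟨X, d, ε, hX, hε⟩ := hN
  ⟨X, d, ε, fun i hi ↦ h _ (hX i hi), hε⟩

theorem hasResolutionOfLength_zero (hN : 𝒳 N) : HasResolutionOfLength 𝒳 N 0 := by
  refine ⟨fun | 0 => N | _ + 1 => .of S PUnit, fun _ ↦ 0, .id, ?_, ?_, Function.surjective_id,
    (LinearMap.exact_zero_iff_injective _ _).2 Function.injective_id, fun _ x ↦ ?_⟩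
  · rintro (_ | i) hi
    exacts [hN, absurd hi (by simp)]
  · rintro (_ | i) hi
    exacts [absurd hi (by simp), inferInstanceAs (Subsingleton PUnit)]
  · exact ⟨fun _ ↦ ⟨0, rfl⟩, fun _ ↦ rfl⟩

theorem hasResolutionOfLength_zero_iff [𝒳.IsClosedUnderIsomorphisms] :
    HasResolutionOfLength 𝒳 N 0 ↔ 𝒳 N := by
  refine ⟨fun ⟨X, d, ε, hX, subsingleton, surjective_ε, exact_ε, _⟩ ↦ ?_,
    hasResolutionOfLength_zero⟩
  have := subsingleton 1 one_pos
  have injective_ε : Function.Injective ε := by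
    rw [← LinearMap.exact_zero_iff_injective (X 1), ← Subsingleton.elim (d 0) 0]
    exact exact_ε
  exact 𝒳.prop_of_iso (LinearEquiv.ofBijective ε ⟨injective_ε, surjective_ε⟩).toModuleIso
    (hX 0 le_rfl)

theorem hasResolutionOfLength_succ {n : ℕ} {K X : ModuleCat.{u} S} {f : K →ₗ[S] X}
    {g : X →ₗ[S] N} (h : IsShortExact f g) (hX : 𝒳 X) (hK : HasResolutionOfLength 𝒳 K n) :
    HasResolutionOfLength 𝒳 N (n + 1) := by
  obtain ⟨Y, d, ε, hY, subsingleton, surjective_ε, exact_ε, exact_d⟩ := hK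
  refine ⟨fun | 0 => X | i + 1 => Y i, fun | 0 => f ∘ₗ ε | i + 1 => d i, g, ?_, ?_,
    h.surjective, ?_, ?_⟩
  · rintro (_ | i) hi
    exacts [hX, hY i (Nat.le_of_succ_le_succ hi)]
  · rintro (_ | i) hi
    exacts [absurd hi (Nat.not_lt_zero _), subsingleton i (Nat.lt_of_succ_lt_succ hi)]
  · exact surjective_ε.comp_exact_iff_exact.2 h.exact
  · rintro (_ | i)
    exacts [h.injective.comp_exact_iff_exact.2 exact_ε, exact_d i]

theorem HasResolutionOfLength.exists_isShortExact {n : ℕ}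
    (h : HasResolutionOfLength 𝒳 N (n + 1)) :
    ∃ (K X : ModuleCat.{u} S) (f : K →ₗ[S] X) (g : X →ₗ[S] N),
      IsShortExact f g ∧ 𝒳 X ∧ HasResolutionOfLength 𝒳 K n := by
  obtain ⟨X, d, ε, hX, subsingleton, surjective_ε, exact_ε, exact_d⟩ := h
  refine ⟨.of S (LinearMap.ker ε), X 0, _, ε, isShortExact_subtype_ker surjective_ε,
    hX 0 (Nat.zero_le _), fun i ↦ X (i + 1), fun i ↦ d (i + 1),
    (d 0).codRestrict _ exact_ε.apply_apply_eq_zero, fun i hi ↦ hX _ (Nat.succ_le_succ hi),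
    fun i hi ↦ subsingleton _ (Nat.succ_lt_succ hi), fun ⟨x, hx⟩ ↦ ?_, fun x ↦ ?_,
    fun i ↦ exact_d (i + 1)⟩
  · obtain ⟨y, rfl⟩ := (exact_ε x).1 hx
    exact ⟨y, rfl⟩
  · rw [← exact_d 0 x, ← Subtype.coe_inj]
    rfl

theorem relPd_le {n : ℕ} (h : HasResolutionOfLength 𝒳 N n) : relPd 𝒳 N ≤ n :=
  iInf₂_le n h

theorem hasResolutionOfLength_of_relPd_eq {n : ℕ} (h : relPd 𝒳 N = n) :
    HasResolutionOfLength 𝒳 N n := by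
  have hlt : relPd 𝒳 N < (n + 1 : ℕ) := by
    rw [h]
    exact_mod_cast n.lt_succ_self
  simp only [relPd, iInf_lt_iff, Nat.cast_lt] at hlt
  obtain ⟨m, hm, hmn⟩ := hlt
  have hnm : n ≤ m := Nat.cast_le.1 (h.symm.le.trans (relPd_le hm))
  rwa [show n = m by lia]

end RelativeDimension

section AuslanderBuchweitz

variable {S : Type u} [Ring S]

/-- The hypotheses of Auslander–Buchweitz approximation theory: `𝒜` is closed under extensions and
kernels of epimorphisms, and `ℐ ⊆ 𝒜` is a cogenerator for `𝒜`. -/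
structure IsCogeneratedBy (𝒜 ℐ : ObjectProperty (ModuleCat.{u} S)) : Prop where
  le : ℐ ≤ 𝒜
  extension {L M N : ModuleCat.{u} S} {f : L →ₗ[S] M} {g : M →ₗ[S] N} :
    IsShortExact f g → 𝒜 L → 𝒜 N → 𝒜 M
  kernel {L M N : ModuleCat.{u} S} {f : L →ₗ[S] M} {g : M →ₗ[S] N} :
    IsShortExact f g → 𝒜 M → 𝒜 N → 𝒜 L
  exists_isShortExact {N : ModuleCat.{u} S} : 𝒜 N →
    ∃ (U V : ModuleCat.{u} S) (f : N →ₗ[S] U) (g : U →ₗ[S] V), IsShortExact f g ∧ ℐ U ∧ 𝒜 V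

namespace IsCogeneratedBy

variable {𝒜 ℐ : ObjectProperty (ModuleCat.{u} S)} (h : IsCogeneratedBy 𝒜 ℐ) {n : ℕ}
  {N : ModuleCat.{u} S}
include h

theorem exists_approximation_of_hull {K X H B : ModuleCat.{u} S} {i : K →ₗ[S] X} {p : X →ₗ[S] N}
    {a : K →ₗ[S] H} {b : H →ₗ[S] B} (hp : IsShortExact i p) (hb : IsShortExact a b) (hX : 𝒜 X)
    (hB : 𝒜 B) :
    ∃ (A : ModuleCat.{u} S) (f : H →ₗ[S] A) (g : A →ₗ[S] N), IsShortExact f g ∧ 𝒜 A := by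
  obtain ⟨A, v, u, pushout⟩ := exists_isPushoutSquare i a
  obtain ⟨q, hq⟩ := pushout.exists_isShortExact hp
  obtain ⟨r, hr⟩ := pushout.symm.exists_isShortExact hb
  exact ⟨A, u, q, hq, h.extension hr hX hB⟩

theorem relPd_eq_of_approximation {H A : ModuleCat.{u} S} {f : H →ₗ[S] A} {g : A →ₗ[S] N}
    (hg : IsShortExact f g) (hA : 𝒜 A) (hH : HasResolutionOfLength ℐ H n)
    (hN : relPd 𝒜 N = (n + 1 : ℕ)) : relPd ℐ H = n := by
  refine (relPd_le hH).antisymm (le_iInf₂ fun m hm ↦ Nat.cast_le.2 ?_)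
  have := relPd_le (hasResolutionOfLength_succ hg hA (hm.mono h.le))
  rw [hN, Nat.cast_le] at this
  exact Nat.le_of_succ_le_succ this

variable [𝒜.IsClosedUnderIsomorphisms]

theorem exists_hull (hN : HasResolutionOfLength 𝒜 N n) :
    ∃ (H A : ModuleCat.{u} S) (f : N →ₗ[S] H) (g : H →ₗ[S] A),
      IsShortExact f g ∧ 𝒜 A ∧ HasResolutionOfLength ℐ H n := by
  induction n generalizing N with
  | zero =>
    obtain ⟨U, V, f, g, hg, hU, hV⟩ := h.exists_isShortExact (hasResolutionOfLength_zero_iff.1 hN)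
    exact ⟨U, V, f, g, hg, hV, hasResolutionOfLength_zero hU⟩
  | succ n ih =>
    obtain ⟨K, X, i, p, hp, hX, hK⟩ := hN.exists_isShortExact
    obtain ⟨H, B, a, b, hb, hB, hH⟩ := ih hK
    obtain ⟨A, u, q, hq, hA⟩ := h.exists_approximation_of_hull hp hb hX hB
    obtain ⟨U, V, w, z, hz, hU, hV⟩ := h.exists_isShortExact hA
    obtain ⟨H', f, t, pushout⟩ := exists_isPushoutSquare q w
    obtain ⟨g, hg⟩ := pushout.symm.exists_isShortExact hz
    exact ⟨H', V, f, g, hg, hV,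
      hasResolutionOfLength_succ (pushout.isShortExact_comp hq hz.injective) hU hH⟩

theorem exists_approximation (hN : HasResolutionOfLength 𝒜 N (n + 1)) :
    ∃ (H A : ModuleCat.{u} S) (f : H →ₗ[S] A) (g : A →ₗ[S] N),
      IsShortExact f g ∧ 𝒜 A ∧ HasResolutionOfLength ℐ H n := by
  obtain ⟨K, X, i, p, hp, hX, hK⟩ := hN.exists_isShortExact
  obtain ⟨H, B, a, b, hb, hB, hH⟩ := h.exists_hull hK
  obtain ⟨A, f, g, hg, hA⟩ := h.exists_approximation_of_hull hp hb hX hB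
  exact ⟨H, A, f, g, hg, hA, hH⟩

theorem hasResolutionOfLength_kernel {H A : ModuleCat.{u} S} {f : N →ₗ[S] H} {g : H →ₗ[S] A}
    (hg : IsShortExact f g) (hA : 𝒜 A) (hH : HasResolutionOfLength 𝒜 H n) :
    HasResolutionOfLength 𝒜 N n := by
  cases n with
  | zero =>
    exact hasResolutionOfLength_zero (h.kernel hg (hasResolutionOfLength_zero_iff.1 hH) hA)
  | succ n =>
    obtain ⟨K, X, i, p, hp, hX, hK⟩ := hH.exists_isShortExact
    obtain ⟨j, π, hπ⟩ := hg.exists_isShortExact_ker_comp hp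
    have hP : 𝒜 (.of S (LinearMap.ker (g ∘ₗ p))) :=
      h.kernel (isShortExact_subtype_ker (hg.surjective.comp hp.surjective)) hX hA
    exact hasResolutionOfLength_succ hπ hP hK

theorem relPd_eq_of_hull {H A : ModuleCat.{u} S} {f : N →ₗ[S] H} {g : H →ₗ[S] A}
    (hg : IsShortExact f g) (hA : 𝒜 A) (hH : HasResolutionOfLength ℐ H n)
    (hN : relPd 𝒜 N = n) : relPd ℐ H = n :=
  (relPd_le hH).antisymm <| le_iInf₂ fun _ hm ↦
    hN ▸ relPd_le (h.hasResolutionOfLength_kernel hg hA (hm.mono h.le))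

end IsCogeneratedBy

end AuslanderBuchweitz

section Semidualizing

variable {R S : Type u} [Ring R] [Ring S]
variable {C : Type u} [AddCommGroup C] [Module R C] [Module Sᵐᵒᵖ C] [SMulCommClass R Sᵐᵒᵖ C]

instance : (auslanderClass R S C).IsClosedUnderIsomorphisms where
  of_iso e := InAuslanderClass.of_linearEquiv e.toLinearEquiv

theorem IsRightSemidualizing.isCogeneratedBy (hC : IsRightSemidualizing R S C) :
    IsCogeneratedBy (auslanderClass R S C) (cInjective R S C) where
  le := hC.cInjective_le_auslanderClass
  extension := InAuslanderClass.extension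
  kernel := InAuslanderClass.kernel
  exists_isShortExact := hC.exists_isShortExact_cInjective

end Semidualizing

end SemidualizingBimodule

open SemidualizingBimodule in
theorem corollary4p6_general {R S : Type u} [Ring R] [Ring S]
    {C : Type u} [AddCommGroup C] [Module R C] [Module Sᵐᵒᵖ C] [SMulCommClass R Sᵐᵒᵖ C]
    (hC : IsRightSemidualizing R S C) (N : ModuleCat.{u} S) (n : ℕ)
    (hN : relPd (auslanderClass R S C) N = (n : ℕ∞)) :
    (∃ (H A : ModuleCat.{u} S) (f : H →ₗ[S] A) (g : A →ₗ[S] N),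
      Function.Injective f ∧ Function.Exact f g ∧ Function.Surjective g ∧
      auslanderClass R S C A ∧ (n = 0 → Subsingleton H) ∧
      (1 ≤ n → relPd (cInjective R S C) H = ((n - 1 : ℕ) : ℕ∞))) ∧
    (∃ (H' A' : ModuleCat.{u} S) (f' : N →ₗ[S] H') (g' : H' →ₗ[S] A'),
      Function.Injective f' ∧ Function.Exact f' g' ∧ Function.Surjective g' ∧
      auslanderClass R S C A' ∧ relPd (cInjective R S C) H' = (n : ℕ∞)) := by
  have h := hC.isCogeneratedBy
  have resolution := hasResolutionOfLength_of_relPd_eq hN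
  constructor
  · cases n with
    | zero =>
      exact ⟨.of S PUnit, N, 0, .id, Function.injective_of_subsingleton _,
        (LinearMap.exact_zero_iff_injective _ _).2 Function.injective_id, Function.surjective_id,
        hasResolutionOfLength_zero_iff.1 resolution, fun _ ↦ inferInstanceAs (Subsingleton PUnit),
        fun hn ↦ absurd hn (by simp)⟩
    | succ n =>
      obtain ⟨H, A, f, g, hg, hA, hH⟩ := h.exists_approximation resolution
      exact ⟨H, A, f, g, hg.injective, hg.exact, hg.surjective, hA, fun hn ↦ absurd hn (by simp),
        fun _ ↦ h.relPd_eq_of_approximation hg hA hH hN⟩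
  · obtain ⟨H, A, f, g, hg, hA, hH⟩ := h.exists_hull resolution
    exact ⟨H, A, f, g, hg.injective, hg.exact, hg.surjective, hA,
      h.relPd_eq_of_hull hg hA hH hN⟩

/-- Let `C` be a semidualizing `(R, S)`-bimodule and `N` a left `S`-module of finite Auslander projective
dimension `n`. Then there are exact sequences `0 → H → A → N → 0` and `0 → N → H' → A' → 0` with `A`, `A'`
in the Auslander class, `ℐ_C(S)`-pd `H = n - 1` (which means `H = 0` if `n = 0`), and
`ℐ_C(S)`-pd `H' = n`. -/
theorem corollary4p6 {R S : Type u} [Ring R] [Ring S]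
    {C : Type u} [AddCommGroup C] [Module R C] [Module Sᵐᵒᵖ C] [SMulCommClass R Sᵐᵒᵖ C]
    (hC : SemidualizingBimodule.IsSemidualizing R S C)
    (N : ModuleCat.{u} S) (n : ℕ)
    (hN : SemidualizingBimodule.relPd (SemidualizingBimodule.auslanderClass R S C) N = (n : ℕ∞)) :
    (∃ (H A : ModuleCat.{u} S) (f : H →ₗ[S] A) (g : A →ₗ[S] N),
      Function.Injective f ∧ Function.Exact f g ∧ Function.Surjective g ∧
      SemidualizingBimodule.auslanderClass R S C A ∧
      (n = 0 → Subsingleton H) ∧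
      (1 ≤ n → SemidualizingBimodule.relPd (SemidualizingBimodule.cInjective R S C) H =
        ((n - 1 : ℕ) : ℕ∞))) ∧
    (∃ (H' A' : ModuleCat.{u} S) (f' : N →ₗ[S] H') (g' : H' →ₗ[S] A'),
      Function.Injective f' ∧ Function.Exact f' g' ∧ Function.Surjective g' ∧
      SemidualizingBimodule.auslanderClass R S C A' ∧
      SemidualizingBimodule.relPd (SemidualizingBimodule.cInjective R S C) H' = (n : ℕ∞)) :=
  corollary4p6_general hC.isRightSemidualizing N n hN
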